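/- **Setting.** Let $D$ be a probability distribution of $(X,Y)$, where $X$ takes values in a measurable space $\mathcal X$ (for example $\mathbb R^d$ with its Borel sets) and $Y\in\{-1,1\}$ almost surely. Let $S$ be a set of measurable functions $g:\mathcal X\to\mathbb R$ with $|g(x)|\le 1$ for all $g\in S$, $x\in\mathcal X$, and such that $-g\in S$ whenever $g\in S$. Let $\operatorname{span}(S)$ be its linear span, and for $f\in\operatorname{span}(S)$ let $$\|f\|_1=\inf\Big\{\sum_j|w^j| : f=\sum_{j=1}^n w^jg^j,\ g^j\in S\Big\}.$$ Let $(\phi,\psi)$ be one of the following pairs: - logistic: $\phi(a)=\ln(1+e^{-a})$, $\psi(u)=u$; - exponential: $\phi(a)=e^{-a}$, $\psi(u)=\ln u$; - least squares: $\phi(a)=\tfrac12(a-1)^2$, $\psi(u)=u$; - modified least squares: $\phi(a)=\tfrac12\max(1-a,0)^2$, $\psi(u)=u$; - $p$-norm with real $p\ge2$: $\phi(a)=|a-1|^p$, $\psi(u)=\tfrac1{2(p-1)}u^{2/p}$. Let $\gamma_\phi(\beta)$ be a Lipschitz constant of $\phi$ on $[-\beta,\beta]$, for every $\beta\ge0$.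 For an i.i.d. sample $Z_1^m=((X_i,Y_i))_{i\le m}$ from $D$ put $$Q(f)=E_D\,\phi(f(X)Y),\qquad \hat Q(f)=\frac1m\sum_{i=1}^m\phi(f(X_i)Y_i),\qquad \hat A(f)=\psi(\hat Q(f)),$$ $$R_m(S)=E_{Z_1^m}E_\sigma\sup_{g\in S}\frac1m\sum_{i=1}^m\sigma_i g(X_i),$$ with $\sigma$ uniform on $\{-1,1\}^m$; it is assumed that $Z_1^m\mapsto E_\sigma\sup_{g\in S}\frac1m\sum_i\sigma_ig(X_i)$ is measurable up to null sets. **Algorithm.** Fix, independently of the sample and of its size, $f_0\in\operatorname{span}(S)$, numbers $\varepsilon_k\ge0$ with $\sum_k\varepsilon_k<\infty$, and closed sets $\Lambda_k\subset\mathbb R$ with $0\in\Lambda_k=-\Lambda_k$ whose suprema $h_k=\sup\Lambda_k<\infty$ satisfy $\sum_kh_k=\infty$ and $\sum_kh_k^2<\infty$. Greedy boosting on $Z_1^m$ starts with $\hat f_0=f_0$ and in step $k=0,1,2,\dots$ chooses $\hat\alpha_k\in\Lambda_k$ and $\hat g_k\in S$ with $$\hat A(\hat f_k+\hat\alpha_k\hat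 g_k)\le\inf_{\alpha\in\Lambda_k,\ g\in S}\hat A(\hat f_k+\alpha g)+\varepsilon_k,\qquad \hat f_{k+1}=\hat f_k+\hat\alpha_k\hat g_k .$$ **Theorem 3.1.** Let $k_m\in\mathbb N$ and $\beta_m\in\mathbb R$ be sample-independent sequences with $k_m\to\infty$ and $\gamma_\phi(\beta_m)\,\beta_m\,R_m(S)\to0$ as $m\to\infty$. Suppose that for every $m\ge1$ the algorithm is stopped at a step $\hat k=\hat k(Z_1^m)$ such that, almost surely, $\hat k\ge k_m$ and $\|\hat f_{\hat k}\|_1\le\beta_m$, and that $\hat f_{\hat k}$ is a measurable estimator, that is, $(Z_1^m,x)\mapsto\hat f_{\hat k}(x)$ is jointly measurable. Then $\phi(f(X)Y)$ is integrable for every $f\in\operatorname{span}(S)$, $Q(\hat f_{\hat k})$ is an integrable function of $Z_1^m$ for every $m\ge1$, and $$\lim_{m\to\infty}E_{Z_1^m}Q(\hat f_{\hat k})=\inf_{f\in\operatorname{span}(S)}Q(f).$$ -/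

import Mathlib

open MeasureTheory Filter Topology

noncomputable section

namespace Boosting

/-- The five loss functions: logistic regression, exponential (AdaBoost), least squares,
modified least squares, and the `p`-norm loss with real `p ≥ 2`. -/
inductive Loss : Type where
  | logistic : Loss
  | exponential : Loss
  | leastSquares : Loss
  | modifiedLeastSquares : Loss
  | pNorm (p : ℝ) (hp : 2 ≤ p) : Loss

/-- The loss as a function of the margin `a = f(x) y`.  For `y = ±1` one has
`(f - y)² = (f y - 1)²` and `|f - y|^p = |f y - 1|^p`. -/
def Loss.phi : Loss → ℝ → ℝ
  | .logistic, a => Real.log (1 + Real.exp (-a))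
  | .exponential, a => Real.exp (-a)
  | .leastSquares, a => (a - 1) ^ 2 / 2
  | .modifiedLeastSquares, a => (max (1 - a) 0) ^ 2 / 2
  | .pNorm p _, a => |a - 1| ^ p

/-- The increasing auxiliary function `ψ` attached to each loss. -/
def Loss.psi : Loss → ℝ → ℝ
  | .logistic, u => u
  | .exponential, u => Real.log u
  | .leastSquares, u => u
  | .modifiedLeastSquares, u => u
  | .pNorm p _, u => 1 / (2 * (p - 1)) * u ^ (2 / p)

variable {X : Type*}

/-- The 1-norm of `f ∈ span S` with respect to the basis `S`: the infimum of `∑ |w j|` over all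
finite representations `f = ∑ w j • g j` with `g j ∈ S`. -/
def oneNorm (S : Set (X → ℝ)) (f : X → ℝ) : ℝ :=
  sInf {r : ℝ | ∃ (n : ℕ) (w : Fin n → ℝ) (g : Fin n → X → ℝ),
    (∀ j, g j ∈ S) ∧ f = ∑ j, w j • g j ∧ r = ∑ j, |w j|}

/-- True risk `Q(f) = E_D φ(f(X) Y)`. -/
def risk [MeasurableSpace X] (D : Measure (X × ℝ)) (φ : ℝ → ℝ) (f : X → ℝ) : ℝ :=
  ∫ z, φ (f z.1 * z.2) ∂D

/-- Empirical risk `Q̂(f) = (1/m) ∑ φ(f(X_i) Y_i)` on the sample `z`. -/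
def empRisk {m : ℕ} (z : Fin m → X × ℝ) (φ : ℝ → ℝ) (f : X → ℝ) : ℝ :=
  (1 / (m : ℝ)) * ∑ i, φ (f (z i).1 * (z i).2)

/-- Empirical objective `Â(f) = ψ(Q̂(f))`. -/
def empObjective (L : Loss) {m : ℕ} (z : Fin m → X × ℝ) (f : X → ℝ) : ℝ :=
  L.psi (empRisk z L.phi f)

/-- The law of an i.i.d. sample of size `m` from `D`. -/
def sampleLaw [MeasurableSpace X] (D : Measure (X × ℝ)) (m : ℕ) : Measure (Fin m → X × ℝ) :=
  Measure.pi fun _ => D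

/-- One-sided sample-dependent Rademacher complexity
`E_σ sup_{g ∈ S} (1/m) ∑ σ_i g(x_i)`, with `σ` uniform on `{1, -1}^m`. -/
def empRademacher (S : Set (X → ℝ)) {m : ℕ} (x : Fin m → X) : ℝ :=
  (1 / (2 : ℝ) ^ m) * ∑ σ : Fin m → ℤˣ,
    ⨆ g : S, (1 / (m : ℝ)) * ∑ i, ((σ i : ℤ) : ℝ) * (g : X → ℝ) (x i)

/-- Expected Rademacher complexity `R_m(S)`. -/
def rademacher [MeasurableSpace X] (D : Measure (X × ℝ)) (S : Set (X → ℝ)) (m : ℕ) : ℝ :=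
  ∫ z, empRademacher S (fun i => (z i).1) ∂(sampleLaw D m)

/-- `f 0, …, f K` are iterates of greedy boosting for the objective `A` over the basis `S`, with
starting point `f₀`, tolerances `ε k` and step sets `Λ k`.  In each step the pair `(α, g)` is an
`ε k`-approximate minimizer: the value reached is at most `A (f k + α' g') + ε k` for all
`α' ∈ Λ k`, `g' ∈ S`, i.e. at most the infimum of these values plus `ε k`. -/
def IsGreedyBoosting (S : Set (X → ℝ)) (A : (X → ℝ) → ℝ) (f₀ : X → ℝ) (ε : ℕ → ℝ)
    (Λ : ℕ → Set ℝ) (K : ℕ) (f : ℕ → X → ℝ) : Prop :=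
  f 0 = f₀ ∧ ∀ k < K, ∃ α ∈ Λ k, ∃ g ∈ S, f (k + 1) = f k + α • g ∧
    ∀ α' ∈ Λ k, ∀ g' ∈ S, A (f k + α • g) ≤ A (f k + α' • g') + ε k

end Boosting

end

/-!
Consistency of greedy boosting with early stopping.  The proof works with the empirical risk `Q̂`
itself; the transform `ψ` matters only in the greedy rule.

*Optimization.*  Since `Q̂` of the iterates stays bounded and `ψ⁻¹` is Lipschitz on bounded sets
(`Loss.exists_bound_of_psi_le`, `Loss.exists_le_add_of_psi_le`), an `ε k`-approximate minimizer of
`ψ ∘ Q̂` is a `K * ε k`-approximate minimizer of `Q̂`.  Each loss is convex with curvature controlled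
by its own value (`Loss.exists_quadratic_bounds`).  So if a step of length `h k` gains little, the
slope of `Q̂` is small along all of `S`, hence along the direction of a competitor `f'`, and the
excess risk over `f'` is small by convexity (`excess_le_of_greedy_step`).  With `s k` equal to a
constant plus the sum of the first `k` step lengths, `s k` times the excess risk grows by at most
`s (k + 1) * η k`, where `η` is summable; as `s k → ∞`, the excess is below a null sequence which
is the same for all samples (`exists_empRisk_greedy_le`).

*Estimation.*  The expected gap between `Q` and `Q̂` at the estimator is at most
`2 * γ (β m) * β m * R_m(S)` (`IsBoundedEstimator.integral_risk_le`), by symmetrization and the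
contraction principle (`sum_iSup_sign_sum_le`).  Symmetrization exchanges sample points with those
of an independent copy in the argument of the estimator; this needs joint measurability of the
estimator only, and the supremum over the ball of radius `β m` enters pointwise.

The two parts bound the expected risk by `Q f'` plus a null sequence for every `f'` in the span.
The lower bound holds because the estimator lies in the span.

Membership in a ball of the 1-norm is used only through linear functionals (directional
derivatives, signed sample means, point evaluations), and is therefore encoded dually (`DualBound`).
-/

noncomputable section

namespace Boosting

/-! ### The loss functions -/

theorem Loss.phi_continuous (L : Loss) : Continuous L.phi := by
  cases L with
  | logistic =>
    refine Continuous.log (by fun_prop) fun a => ?_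
    positivity
  | exponential => exact Real.continuous_exp.comp continuous_neg
  | leastSquares => exact show Continuous fun a : ℝ => (a - 1) ^ 2 / 2 by fun_prop
  | modifiedLeastSquares => exact show Continuous fun a : ℝ => (max (1 - a) 0) ^ 2 / 2 by fun_prop
  | pNorm p hp =>
    exact Continuous.rpow_const (by fun_prop) fun a => Or.inr (by linarith)

theorem Loss.phi_nonneg (L : Loss) (a : ℝ) : 0 ≤ L.phi a := by
  cases L with
  | logistic => exact Real.log_nonneg (by linarith [Real.exp_pos (-a)])
  | exponential => exact (Real.exp_pos _).le
  | leastSquares => simp only [Loss.phi]; positivity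
  | modifiedLeastSquares => simp only [Loss.phi]; positivity
  | pNorm p hp => simp only [Loss.phi]; positivity

theorem exp_le_one_add_add_sq {x H : ℝ} (hx : |x| ≤ H) :
    Real.exp x ≤ 1 + x + Real.exp H * x ^ 2 := by
  have h1 : Real.exp x - 1 ≤ x * Real.exp x := by
    have h := Real.add_one_le_exp (-x)
    have h2 : Real.exp (-x) * Real.exp x = 1 := by rw [← Real.exp_add]; simp
    nlinarith [Real.exp_pos x]
  have h0 := Real.add_one_le_exp x
  have h3 : Real.exp x ≤ Real.exp H := Real.exp_le_exp.2 ((le_abs_self x).trans hx)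
  have h4 : 1 ≤ Real.exp H := Real.one_le_exp ((abs_nonneg x).trans hx)
  rcases le_total 0 x with h | h
  · nlinarith [mul_nonneg h h]
  · nlinarith [mul_nonneg_of_nonpos_of_nonpos h h]

/-- The derivative of `|t| ^ p / p` is again differentiable for `p ≥ 2`, also at the origin. -/
theorem hasDerivAt_abs_rpow_sub_two_mul {p : ℝ} (hp : 2 ≤ p) (x : ℝ) :
    HasDerivAt (fun t : ℝ => |t| ^ (p - 2) * t) ((p - 1) * |x| ^ (p - 2)) x := by
  rcases hp.eq_or_lt with rfl | hp
  · simpa using (hasDerivAt_id' x).congr_deriv (by norm_num : (1 : ℝ) = 2 - 1)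
  rcases eq_or_ne x 0 with rfl | hx
  · rw [hasDerivAt_iff_tendsto_slope]
    have hc : Continuous fun t : ℝ => |t| ^ (p - 2) :=
      Continuous.rpow_const (by fun_prop) fun a => Or.inr (by linarith)
    have := (hc.tendsto 0).mono_left (nhdsWithin_le_nhds (s := {0}ᶜ))
    have e : (p - 1) * |(0 : ℝ)| ^ (p - 2) = |(0 : ℝ)| ^ (p - 2) := by
      rw [abs_zero, Real.zero_rpow (by linarith)]; simp
    rw [e]
    refine this.congr' ?_
    filter_upwards [self_mem_nhdsWithin] with t ht
    have ht : t ≠ 0 := ht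
    simp [slope_def_field]
    field_simp
  · have h1 : HasDerivAt (fun t : ℝ => |t| ^ (p - 2))
        ((p - 2) * |x| ^ (p - 2 - 1) * SignType.sign x) x := by
      have := (hasDerivAt_abs hx).rpow_const (p := p - 2) (Or.inl (abs_ne_zero.2 hx))
      exact this.congr_deriv (by ring)
    refine (h1.mul (hasDerivAt_id x)).congr_deriv ?_
    have h2 : |x| ^ (p - 2) = |x| ^ (p - 2 - 1) * |x| := by
      rw [← Real.rpow_add_one (abs_ne_zero.2 hx)]; ring_nf
    have h3 : (SignType.sign x : ℝ) * x = |x| := by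
      rw [mul_comm]; exact self_mul_sign x
    simp only [id]
    rw [h2]
    linear_combination (p - 2) * |x| ^ (p - 2 - 1) * h3

/-- Taylor's formula of order two with an intermediate point, from two applications of the mean
value theorem. -/
theorem exists_second_order_remainder {F G G' : ℝ → ℝ} (hF : ∀ t, HasDerivAt F (G t) t)
    (hG : ∀ t, HasDerivAt G (G' t) t) (x c : ℝ) :
    ∃ θ, 0 < θ ∧ θ < 1 ∧ ∃ τ, 0 < τ ∧ τ < 1 ∧
      F (x + c) = F x + G x * c + G' (x + τ * c) * (θ * c ^ 2) := by
  have hl : ∀ t : ℝ, HasDerivAt (fun t : ℝ => x + t * c) c t := fun t => by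
    simpa using ((hasDerivAt_id' t).mul_const c).const_add x
  have hF' : ∀ t, HasDerivAt (fun t => F (x + t * c)) (G (x + t * c) * c) t := fun t =>
    (hF (x + t * c)).comp t (hl t)
  have hG' : ∀ t, HasDerivAt (fun t => G (x + t * c)) (G' (x + t * c) * c) t := fun t =>
    (hG (x + t * c)).comp t (hl t)
  obtain ⟨θ, ⟨hθ0, hθ1⟩, h1⟩ := exists_hasDerivAt_eq_slope _ _ zero_lt_one
    (fun t _ => (hF' t).continuousAt.continuousWithinAt) fun t _ => hF' t
  obtain ⟨τ, ⟨hτ0, hτ1⟩, h2⟩ := exists_hasDerivAt_eq_slope _ _ hθ0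
    (fun t _ => (hG' t).continuousAt.continuousWithinAt) fun t _ => hG' t
  refine ⟨θ, hθ0, hθ1, τ, hτ0, hτ1.trans hθ1, ?_⟩
  rw [eq_div_iff (by linarith)] at h2
  simp only [zero_mul, add_zero, sub_zero, one_mul, div_one] at h1 h2
  linear_combination -h1 - c * h2

/-- First-order lower bound and second-order upper bound of the loss.  The curvature is controlled
by the value of the loss itself, which is all the exponential loss and the `p`-norm loss allow. -/
theorem Loss.exists_quadratic_bounds (L : Loss) {H : ℝ} (hH : 0 ≤ H) :
    ∃ (d : ℝ → ℝ) (C : ℝ), 0 ≤ C ∧ ∀ v c : ℝ, L.phi v + d v * c ≤ L.phi (v + c) ∧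
      (|c| ≤ H → L.phi (v + c) ≤ L.phi v + d v * c + C * (L.phi v + 1) * c ^ 2) := by
  have hnn := L.phi_nonneg
  cases L with
  | logistic =>
    refine ⟨fun v => -(Real.exp (-v) / (1 + Real.exp (-v))), Real.exp H, by positivity,
      fun v c => ?_⟩
    -- `φ (v + c) - φ v` is the cumulant generating function at `-c` of a Bernoulli variable.
    set p := Real.exp (-v) / (1 + Real.exp (-v)) with hp
    have hv := Real.exp_pos (-v)
    have hp0 : 0 ≤ p := by positivity
    have hp1 : p ≤ 1 := by rw [hp, div_le_one (by positivity)]; linarith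
    have hc : 0 < (1 - p) * 1 + p * Real.exp (-c) := by
      rcases hp1.lt_or_eq with h | h
      · have := Real.exp_pos (-c); nlinarith
      · rw [h]; have := Real.exp_pos (-c); linarith
    have key : Loss.logistic.phi (v + c) =
        Loss.logistic.phi v + Real.log ((1 - p) * 1 + p * Real.exp (-c)) := by
      simp only [Loss.phi]
      rw [← Real.log_mul (by positivity) hc.ne']
      congr 1
      rw [neg_add, Real.exp_add, hp]
      field_simp
      ring
    rw [key]
    have hv0 := hnn v
    refine ⟨?_, fun hcH => ?_⟩
    · have h1 : Real.exp ((1 - p) * 0 + p * -c) ≤ (1 - p) * 1 + p * Real.exp (-c) := by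
        have := convexOn_exp.2 (Set.mem_univ 0) (Set.mem_univ (-c)) (sub_nonneg.2 hp1) hp0
          (by ring)
        simpa using this
      have h2 := (Real.le_log_iff_exp_le hc).2 h1
      linarith
    · have h1 := Real.log_le_sub_one_of_pos hc
      have h2 := exp_le_one_add_add_sq (x := -c) (H := H) (by rwa [abs_neg])
      have h3 : p * Real.exp (-c) ≤ p * (1 + -c + Real.exp H * (-c) ^ 2) := by gcongr
      have h4 : p * (Real.exp H * c ^ 2) ≤ 1 * (Real.exp H * c ^ 2) := by gcongr
      have h5 : 0 ≤ Real.exp H * Loss.logistic.phi v * c ^ 2 := by positivity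
      nlinarith
  | exponential =>
    refine ⟨fun v => -Real.exp (-v), Real.exp H, by positivity, fun v c => ?_⟩
    have hv := Real.exp_pos (-v)
    simp only [Loss.phi]
    rw [neg_add, Real.exp_add]
    refine ⟨?_, fun hcH => ?_⟩
    · have := Real.add_one_le_exp (-c)
      nlinarith
    · have h2 := exp_le_one_add_add_sq (x := -c) (H := H) (by rwa [abs_neg])
      have h3 := mul_le_mul_of_nonneg_left h2 hv.le
      have h4 : 0 ≤ Real.exp H * c ^ 2 := by positivity
      nlinarith
  | leastSquares =>
    refine ⟨fun v => v - 1, 1, zero_le_one, fun v c => ?_⟩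
    simp only [Loss.phi]
    refine ⟨by nlinarith [sq_nonneg c], fun _ => ?_⟩
    nlinarith [mul_nonneg (sq_nonneg (v - 1)) (sq_nonneg c), sq_nonneg c]
  | modifiedLeastSquares =>
    refine ⟨fun v => -max (1 - v) 0, 1, zero_le_one, fun v c => ?_⟩
    simp only [Loss.phi]
    have hA : 0 ≤ (max (1 - v) 0) ^ 2 / 2 * c ^ 2 := by positivity
    have hc := sq_nonneg c
    rcases max_cases (1 - v) 0 with ⟨h, h'⟩ | ⟨h, h'⟩ <;>
    rcases max_cases (1 - (v + c)) 0 with ⟨k, k'⟩ | ⟨k, k'⟩ <;> rw [h] at hA ⊢ <;> rw [k] <;>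
    refine ⟨?_, fun _ => ?_⟩ <;> nlinarith
  | pNorm p hp =>
    refine ⟨fun v => p * (|v - 1| ^ (p - 2) * (v - 1)),
      p * (p - 1) * (2 ^ p * (H + 1) ^ p), by
        have : 0 ≤ p - 1 := by linarith
        positivity, fun v c => ?_⟩
    have hp1 : 0 ≤ p * (p - 1) := mul_nonneg (by linarith) (by linarith)
    have hF : ∀ t, HasDerivAt (fun t : ℝ => |t| ^ p) (p * (|t| ^ (p - 2) * t)) t := fun t =>
      (hasDerivAt_abs_rpow t (by linarith)).congr_deriv (by ring)
    have hG : ∀ t, HasDerivAt (fun t : ℝ => p * (|t| ^ (p - 2) * t))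
        (p * (p - 1) * |t| ^ (p - 2)) t := fun t =>
      ((hasDerivAt_abs_rpow_sub_two_mul hp t).const_mul p).congr_deriv (by ring)
    obtain ⟨θ, hθ0, hθ1, τ, hτ0, hτ1, hθ⟩ := exists_second_order_remainder hF hG (v - 1) c
    have e : v + c - 1 = v - 1 + c := by ring
    simp only [Loss.phi, e, hθ]
    have hr : 0 ≤ θ * c ^ 2 := by positivity
    have hq := Real.rpow_nonneg (abs_nonneg (v - 1 + τ * c)) (p - 2)
    refine ⟨by nlinarith [mul_nonneg (mul_nonneg hp1 hq) hr], fun hcH => ?_⟩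
    have hb : |v - 1 + τ * c| ^ (p - 2) ≤ 2 ^ p * (H + 1) ^ p * (|v - 1| ^ p + 1) := by
      have h1 : |v - 1 + τ * c| ≤ |v - 1| + (H + 1) := by
        have h2 := abs_add_le (v - 1) (τ * c)
        have h3 : |τ * c| ≤ 1 * |c| := by
          rw [abs_mul, abs_of_pos hτ0]; gcongr
        linarith
      have hx := abs_nonneg (v - 1)
      have hxp := Real.rpow_nonneg hx p
      have hK1 : 1 ≤ (H + 1) ^ p := Real.one_le_rpow (by linarith) (by linarith)
      have h2p : (0 : ℝ) ≤ 2 ^ p := by positivity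
      -- The summand `1` makes the base at least `1`, so that the exponent may be raised to `p`.
      calc |v - 1 + τ * c| ^ (p - 2) ≤ (|v - 1| + (H + 1)) ^ (p - 2) := by
            gcongr
        _ ≤ (|v - 1| + (H + 1)) ^ p :=
            Real.rpow_le_rpow_of_exponent_le (by linarith) (by linarith)
        _ ≤ 2 ^ p * (|v - 1| ^ p + (H + 1) ^ p) := by
            rcases le_total |v - 1| (H + 1) with h | h
            · calc (|v - 1| + (H + 1)) ^ p ≤ (2 * (H + 1)) ^ p := by gcongr; linarith
                _ = 2 ^ p * (H + 1) ^ p := Real.mul_rpow (by norm_num) (by linarith)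
                _ ≤ _ := by gcongr; linarith
            · calc (|v - 1| + (H + 1)) ^ p ≤ (2 * |v - 1|) ^ p := by gcongr; linarith
                _ = 2 ^ p * |v - 1| ^ p := Real.mul_rpow (by norm_num) hx
                _ ≤ _ := by gcongr; linarith
        _ ≤ 2 ^ p * ((H + 1) ^ p * (|v - 1| ^ p + 1)) := by gcongr; nlinarith
        _ = _ := by ring
    have h4 : θ * c ^ 2 ≤ 1 * c ^ 2 := by gcongr
    have h5 := mul_le_mul (mul_le_mul_of_nonneg_left hb hp1) h4 hr (by positivity)
    nlinarith

theorem Loss.phi_pos_of_exponential {L : Loss} (hL : L = .exponential) (a : ℝ) : 0 < L.phi a := by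
  subst hL; exact Real.exp_pos _

theorem rpow_sub_rpow_le {q x y B : ℝ} (hq : 1 ≤ q) (hx : 0 ≤ x) (hxy : x ≤ y) (hyB : y ≤ B) :
    y ^ q - x ^ q ≤ q * B ^ (q - 1) * (y - x) := by
  rcases hxy.eq_or_lt with rfl | hlt
  · simp
  obtain ⟨ξ, hξ, h⟩ := exists_hasDerivAt_eq_slope (fun t : ℝ => t ^ q) (fun t => q * t ^ (q - 1))
    hlt (Continuous.continuousOn (Real.continuous_rpow_const (by linarith)))
    fun t _ => Real.hasDerivAt_rpow_const (Or.inr hq)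
  have hξ0 : 0 ≤ ξ := hx.trans hξ.1.le
  rw [eq_div_iff (by linarith)] at h
  rw [← h]
  have : ξ ^ (q - 1) ≤ B ^ (q - 1) := Real.rpow_le_rpow hξ0 (by linarith [hξ.2]) (by linarith)
  gcongr

theorem rpow_two_div_rpow_half {p t : ℝ} (hp : 0 < p) (ht : 0 ≤ t) :
    (t ^ (2 / p)) ^ (p / 2) = t := by
  rw [← Real.rpow_mul ht, show 2 / p * (p / 2) = 1 by field_simp, Real.rpow_one]

/-- A bound on `ψ u` in terms of `ψ u'` bounds `u` in terms of `u'`.  For the exponential loss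
`ψ = log` and positivity has to be assumed, because `log 0 = 0`. -/
theorem Loss.exists_bound_of_psi_le (L : Loss) (B E : ℝ) :
    ∃ B', ∀ u u' : ℝ, 0 ≤ u → 0 ≤ u' → (L = .exponential → 0 < u ∧ 0 < u') → u' ≤ B →
      L.psi u ≤ L.psi u' + E → u ≤ B' := by
  cases L with
  | exponential =>
    refine ⟨Real.exp (Real.log B + E), fun u u' _ _ hpos hB h => ?_⟩
    obtain ⟨hu, hu'⟩ := hpos rfl
    have h1 := Real.log_le_log hu' hB
    simp only [Loss.psi] at h
    exact (Real.log_le_iff_le_exp hu).1 (by linarith)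
  | pNorm p hp =>
    refine ⟨(B ^ (2 / p) + 2 * (p - 1) * E) ^ (p / 2), fun u u' hu hu' _ hB h => ?_⟩
    have hp1 : 0 < p - 1 := by linarith
    have h1 : u' ^ (2 / p) ≤ B ^ (2 / p) := by gcongr
    have h2 : u ^ (2 / p) ≤ B ^ (2 / p) + 2 * (p - 1) * E := by
      simp only [Loss.psi] at h
      field_simp at h
      linarith
    calc u = (u ^ (2 / p)) ^ (p / 2) := (rpow_two_div_rpow_half (by linarith) hu).symm
      _ ≤ _ := by gcongr
  | logistic | leastSquares | modifiedLeastSquares =>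
    exact ⟨B + E, fun u u' _ _ _ hB h => by simp only [Loss.psi] at h; linarith⟩

/-- On bounded sets `ψ⁻¹` is Lipschitz: an additive tolerance in `ψ` is, up to a constant, an
additive tolerance in its argument. -/
theorem Loss.exists_le_add_of_psi_le (L : Loss) (B : ℝ) :
    ∃ K, 0 ≤ K ∧ ∀ u u' δ : ℝ, 0 ≤ u → 0 ≤ u' → (L = .exponential → 0 < u ∧ 0 < u') → u ≤ B →
      0 ≤ δ → L.psi u ≤ L.psi u' + δ → u ≤ u' + K * δ := by
  cases L with
  | exponential =>
    refine ⟨max B 0, le_max_right _ _, fun u u' δ _ _ hpos hB hδ h => ?_⟩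
    obtain ⟨hu, hu'⟩ := hpos rfl
    simp only [Loss.psi] at h
    have h1 : u ≤ u' * Real.exp δ := by
      rw [← Real.log_le_log_iff hu (by positivity), Real.log_mul hu'.ne' (Real.exp_pos _).ne',
        Real.log_exp]
      exact h
    have h2 : u * Real.exp (-δ) ≤ u' := by
      rw [Real.exp_neg, ← div_eq_mul_inv, div_le_iff₀ (Real.exp_pos _)]; exact h1
    have h3 := Real.add_one_le_exp (-δ)
    have h4 : u * δ ≤ max B 0 * δ := by gcongr; exact hB.trans (le_max_left _ _)
    nlinarith
  | pNorm p hp =>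
    have hp1 : 0 < p - 1 := by linarith
    refine ⟨p / 2 * (max B 0 ^ (2 / p)) ^ (p / 2 - 1) * (2 * (p - 1)), by positivity,
      fun u u' δ hu hu' _ hB hδ h => ?_⟩
    have hB' : 0 ≤ max B 0 := le_max_right _ _
    rcases le_total u u' with hle | hle
    · have : 0 ≤ p / 2 * (max B 0 ^ (2 / p)) ^ (p / 2 - 1) * (2 * (p - 1)) * δ := by positivity
      linarith
    have h2 : u ^ (2 / p) - u' ^ (2 / p) ≤ 2 * (p - 1) * δ := by
      simp only [Loss.psi] at h
      field_simp at h
      linarith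
    have h3 := rpow_sub_rpow_le (q := p / 2) (by linarith) (Real.rpow_nonneg hu' (2 / p))
      (Real.rpow_le_rpow hu' hle (by positivity))
      (Real.rpow_le_rpow hu (hB.trans (le_max_left B 0)) (by positivity))
    rw [rpow_two_div_rpow_half (by linarith) hu, rpow_two_div_rpow_half (by linarith) hu'] at h3
    have h4 : p / 2 * (max B 0 ^ (2 / p)) ^ (p / 2 - 1) * (u ^ (2 / p) - u' ^ (2 / p)) ≤
        p / 2 * (max B 0 ^ (2 / p)) ^ (p / 2 - 1) * (2 * (p - 1) * δ) := by gcongr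
    linarith
  | logistic | leastSquares | modifiedLeastSquares =>
    exact ⟨1, zero_le_one, fun u u' δ _ _ _ _ _ h => by simp only [Loss.psi] at h; linarith⟩

variable {X : Type*}

/-! ### Balls of the 1-norm -/

/-- `f` lies in `r` times the absolutely convex hull of `S`, expressed dually: a linear functional
bounded by `K` on `S` is bounded by `r * K` at `f`. -/
def DualBound (S : Set (X → ℝ)) (f : X → ℝ) (r : ℝ) : Prop :=
  ∀ (ℓ : (X → ℝ) →ₗ[ℝ] ℝ) (K : ℝ), 0 ≤ K → (∀ g ∈ S, |ℓ g| ≤ K) → |ℓ f| ≤ r * K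

namespace DualBound

variable {S : Set (X → ℝ)} {f g : X → ℝ} {r s : ℝ}

theorem smul_of_mem (hg : g ∈ S) (a : ℝ) : DualBound S (a • g) |a| := fun ℓ K _ h => by
  rw [map_smul, smul_eq_mul, abs_mul]
  gcongr
  exact h g hg

theorem add (hf : DualBound S f r) (hg : DualBound S g s) : DualBound S (f + g) (r + s) :=
  fun ℓ K hK h => by
    rw [map_add, add_mul]
    exact (abs_add_le _ _).trans (add_le_add (hf ℓ K hK h) (hg ℓ K hK h))

theorem neg (hf : DualBound S f r) : DualBound S (-f) r := fun ℓ K hK h => by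
  rw [map_neg, abs_neg]; exact hf ℓ K hK h

theorem mono (hf : DualBound S f r) (h : r ≤ s) : DualBound S f s := fun ℓ K hK hg =>
  (hf ℓ K hK hg).trans (mul_le_mul_of_nonneg_right h hK)

theorem sum {n : ℕ} (w : Fin n → ℝ) (g : Fin n → X → ℝ) (hg : ∀ j, g j ∈ S) :
    DualBound S (∑ j, w j • g j) (∑ j, |w j|) := fun ℓ K hK h => by
  rw [map_sum, Finset.sum_mul]
  exact (Finset.abs_sum_le_sum_abs _ _).trans
    (Finset.sum_le_sum fun j _ => smul_of_mem (hg j) (w j) ℓ K hK h)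

theorem abs_apply_le (hf : DualBound S f r) (hS : ∀ g ∈ S, ∀ x, |g x| ≤ 1) (x : X) :
    |f x| ≤ r := by
  simpa using hf (LinearMap.proj x) 1 zero_le_one fun g hg => hS g hg x

end DualBound

theorem exists_eq_sum_of_mem_span {S : Set (X → ℝ)} {f : X → ℝ} (hf : f ∈ Submodule.span ℝ S) :
    ∃ (n : ℕ) (w : Fin n → ℝ) (g : Fin n → X → ℝ), (∀ j, g j ∈ S) ∧ f = ∑ j, w j • g j := by
  obtain ⟨n, w, g, h⟩ := Submodule.mem_span_set'.1 hf
  exact ⟨n, w, fun j => g j, fun j => (g j).2, h.symm⟩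

theorem exists_dualBound_of_mem_span {S : Set (X → ℝ)} {f : X → ℝ}
    (hf : f ∈ Submodule.span ℝ S) : ∃ r, 0 ≤ r ∧ DualBound S f r := by
  obtain ⟨n, w, g, hg, rfl⟩ := exists_eq_sum_of_mem_span hf
  exact ⟨∑ j, |w j|, Finset.sum_nonneg fun _ _ => abs_nonneg _, DualBound.sum w g hg⟩

theorem oneNorm_nonneg (S : Set (X → ℝ)) (f : X → ℝ) : 0 ≤ oneNorm S f := by
  refine Real.sInf_nonneg ?_
  rintro r ⟨n, w, g, -, -, rfl⟩
  exact Finset.sum_nonneg fun _ _ => abs_nonneg _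

/-- The infimum defining `oneNorm` need not be attained, but the dual bound passes to it. -/
theorem dualBound_oneNorm {S : Set (X → ℝ)} {f : X → ℝ} (hf : f ∈ Submodule.span ℝ S) :
    DualBound S f (oneNorm S f) := by
  intro ℓ K hK h
  refine le_of_forall_pos_le_add fun δ hδ => ?_
  obtain ⟨n, w, g, hg, hfe⟩ := exists_eq_sum_of_mem_span hf
  obtain ⟨r, ⟨n, w, g, hg, hfe, rfl⟩, hr⟩ := exists_lt_of_csInf_lt
    (s := {r : ℝ | ∃ (n : ℕ) (w : Fin n → ℝ) (g : Fin n → X → ℝ),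
      (∀ j, g j ∈ S) ∧ f = ∑ j, w j • g j ∧ r = ∑ j, |w j|})
    ⟨_, n, w, g, hg, hfe, rfl⟩ (lt_add_of_pos_right (oneNorm S f) (by positivity : 0 < δ / (K + 1)))
  have h1 : |ℓ f| ≤ (∑ j, |w j|) * K := by
    rw [hfe]; exact DualBound.sum w g hg ℓ K hK h
  have h2 : (∑ j, |w j|) * K ≤ (oneNorm S f + δ / (K + 1)) * K := by gcongr
  have h3 : δ / (K + 1) * K ≤ δ := by
    rw [div_mul_eq_mul_div, div_le_iff₀ (by positivity)]; nlinarith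
  linarith

/-! ### One greedy step -/

/-- The directional derivative of the empirical risk, if `d` stands for the derivative of the loss
at the margins of the sample. -/
def empSlope {m : ℕ} (z : Fin m → X × ℝ) (d : Fin m → ℝ) : (X → ℝ) →ₗ[ℝ] ℝ where
  toFun c := (1 / (m : ℝ)) * ∑ i, d i * (c (z i).1 * (z i).2)
  map_add' c c' := by
    simp only [Pi.add_apply, add_mul, mul_add, Finset.sum_add_distrib]
  map_smul' a c := by
    simp only [Pi.smul_apply, smul_eq_mul, RingHom.id_apply]
    rw [mul_left_comm a, Finset.mul_sum _ _ a]
    congr 1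
    exact Finset.sum_congr rfl fun i _ => by ring

theorem empRisk_nonneg {m : ℕ} (z : Fin m → X × ℝ) (L : Loss) (f : X → ℝ) :
    0 ≤ empRisk z L.phi f :=
  mul_nonneg (by positivity) (Finset.sum_nonneg fun _ _ => L.phi_nonneg _)

theorem empRisk_pos {m : ℕ} (hm : 0 < m) (z : Fin m → X × ℝ) {L : Loss} (hL : L = .exponential)
    (f : X → ℝ) : 0 < empRisk z L.phi f := by
  have : Nonempty (Fin m) := ⟨⟨0, hm⟩⟩
  exact mul_pos (by positivity)
    (Finset.sum_pos (fun _ _ => Loss.phi_pos_of_exponential hL _) Finset.univ_nonempty)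

theorem empRisk_le {m : ℕ} (hm : 0 < m) (z : Fin m → X × ℝ) {φ : ℝ → ℝ} {f : X → ℝ} {B : ℝ}
    (h : ∀ i, φ (f (z i).1 * (z i).2) ≤ B) : empRisk z φ f ≤ B := by
  have h1 : ∑ i, φ (f (z i).1 * (z i).2) ≤ ∑ _i : Fin m, B := Finset.sum_le_sum fun i _ => h i
  have hm' : (0 : ℝ) < m := by exact_mod_cast hm
  rw [Finset.sum_const, Finset.card_univ, Fintype.card_fin, nsmul_eq_mul] at h1
  rw [empRisk, one_div, inv_mul_le_iff₀ hm']
  exact h1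

theorem abs_mul_label {a y : ℝ} (hy : y = 1 ∨ y = -1) : |a * y| = |a| := by
  rcases hy with rfl | rfl <;> simp

theorem empRisk_add_le {m : ℕ} (hm : 0 < m) (z : Fin m → X × ℝ)
    (hz : ∀ i, (z i).2 = 1 ∨ (z i).2 = -1) {φ d : ℝ → ℝ} {C H h : ℝ} (hC : 0 ≤ C)
    (hφ : ∀ v, 0 ≤ φ v)
    (hd : ∀ v c : ℝ, |c| ≤ H → φ (v + c) ≤ φ v + d v * c + C * (φ v + 1) * c ^ 2)
    (f c : X → ℝ) (hc : ∀ x, |c x| ≤ h) (hH : h ≤ H) :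
    empRisk z φ (f + c) ≤ empRisk z φ f +
      empSlope z (fun i => d (f (z i).1 * (z i).2)) c + C * (empRisk z φ f + 1) * h ^ 2 := by
  have hm' : (0 : ℝ) < m := by exact_mod_cast hm
  have h1 : ∀ i ∈ Finset.univ, φ ((f + c) (z i).1 * (z i).2) ≤ φ (f (z i).1 * (z i).2) +
      d (f (z i).1 * (z i).2) * (c (z i).1 * (z i).2) +
      C * h ^ 2 * (φ (f (z i).1 * (z i).2) + 1) := by
    intro i _
    have ha : |c (z i).1 * (z i).2| ≤ h := (abs_mul_label (hz i)).trans_le (hc _)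
    have h2 := hd (f (z i).1 * (z i).2) (c (z i).1 * (z i).2) (ha.trans hH)
    have h3 : (c (z i).1 * (z i).2) ^ 2 ≤ h ^ 2 := sq_le_sq' (abs_le.1 ha).1 (abs_le.1 ha).2
    have h4 := mul_le_mul_of_nonneg_left h3
      (mul_nonneg hC (by linarith [hφ (f (z i).1 * (z i).2)] : 0 ≤ φ (f (z i).1 * (z i).2) + 1))
    rw [Pi.add_apply, add_mul]
    linarith
  have h2 := Finset.sum_le_sum h1
  rw [Finset.sum_add_distrib, Finset.sum_add_distrib, ← Finset.mul_sum, Finset.sum_add_distrib,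
    Finset.sum_const, Finset.card_univ, Fintype.card_fin, nsmul_eq_mul, mul_one] at h2
  have h3 := mul_le_mul_of_nonneg_left h2 (by positivity : 0 ≤ 1 / (m : ℝ))
  refine h3.trans_eq ?_
  simp only [empRisk, empSlope, LinearMap.coe_mk, AddHom.coe_mk]
  field_simp

theorem empRisk_add_slope_le {m : ℕ} (z : Fin m → X × ℝ) {φ d : ℝ → ℝ}
    (hd : ∀ v c : ℝ, φ v + d v * c ≤ φ (v + c)) (f c : X → ℝ) :
    empRisk z φ f + empSlope z (fun i => d (f (z i).1 * (z i).2)) c ≤ empRisk z φ (f + c) := by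
  simp only [empRisk, empSlope, LinearMap.coe_mk, AddHom.coe_mk]
  rw [← mul_add, ← Finset.sum_add_distrib]
  gcongr with i
  rw [Pi.add_apply, add_mul]
  exact hd _ _

/-- Progress of one step.  If no step of length `t` along a function of the symmetric set `S`
decreases the empirical risk below that of `f'` by more than `δ`, then the progress from `f` to `f'`
bounds the slope along every element of `S`, and so, by convexity, the excess risk over `f + c`. -/
theorem excess_le_of_greedy_step {S : Set (X → ℝ)} (hS : S.Nonempty)
    (hS_bdd : ∀ g ∈ S, ∀ x, |g x| ≤ 1)
    (hS_neg : ∀ g ∈ S, -g ∈ S) {m : ℕ} (hm : 0 < m) (z : Fin m → X × ℝ)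
    (hz : ∀ i, (z i).2 = 1 ∨ (z i).2 = -1) {φ d : ℝ → ℝ} {C H t B δ s : ℝ} (hC : 0 ≤ C)
    (hφ : ∀ v, 0 ≤ φ v)
    (hd : ∀ v c : ℝ, φ v + d v * c ≤ φ (v + c) ∧
      (|c| ≤ H → φ (v + c) ≤ φ v + d v * c + C * (φ v + 1) * c ^ 2))
    (ht : 0 ≤ t) (hH : t ≤ H) {f f' c : X → ℝ} (hB : empRisk z φ f ≤ B)
    (hgreedy : ∀ g ∈ S, empRisk z φ f' ≤ empRisk z φ (f + t • g) + δ)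
    (hc : DualBound S c s) :
    t * (empRisk z φ f - empRisk z φ (f + c)) ≤
      s * (empRisk z φ f - empRisk z φ f' + (δ + C * (B + 1) * t ^ 2)) := by
  set ℓ := empSlope z (fun i => d (f (z i).1 * (z i).2)) with hℓ
  set P := empRisk z φ f - empRisk z φ f' + (δ + C * (B + 1) * t ^ 2) with hP
  have h1 : ∀ g ∈ S, -(t * ℓ g) ≤ P := fun g hg => by
    have h2 := empRisk_add_le hm z hz hC hφ (fun v c => (hd v c).2) f (t • g) (h := t)
      (fun x => by
        rw [Pi.smul_apply, smul_eq_mul, abs_mul, abs_of_nonneg ht]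
        exact mul_le_of_le_one_right ht (hS_bdd g hg x)) hH
    rw [map_smul, smul_eq_mul] at h2
    have h3 := hgreedy g hg
    have h4 : C * (empRisk z φ f + 1) * t ^ 2 ≤ C * (B + 1) * t ^ 2 := by gcongr
    linarith
  have h2 : ∀ g ∈ S, |(t • ℓ) g| ≤ P := fun g hg => by
    have h3 := h1 (-g) (hS_neg g hg)
    rw [map_neg] at h3
    rw [LinearMap.smul_apply, smul_eq_mul, abs_le]
    constructor <;> linarith [h1 g hg]
  obtain ⟨g, hg⟩ := hS
  have h3 := (abs_le.1 (hc (t • ℓ) P ((abs_nonneg _).trans (h2 g hg)) h2)).1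
  rw [LinearMap.smul_apply, smul_eq_mul] at h3
  have h4 := mul_le_mul_of_nonneg_left (empRisk_add_slope_le z (fun v c => (hd v c).1) f c) ht
  linarith

/-- Multiplying an excess-risk recursion by the total step length `s` turns it into a telescoping
one: `1 - t / s ≤ s / (s + t)`. -/
theorem mul_excess_le {s t a a' η : ℝ} (hs : 0 < s) (ht : 0 ≤ t) (hη : 0 ≤ η) (ha : a' ≤ a + η)
    (h : t * a ≤ s * (a - a' + η)) :
    (s + t) * max a' 0 ≤ s * max a 0 + (s + t) * η := by
  have h0 : 0 ≤ (s + t) * η := by positivity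
  rcases le_total a' 0 with h' | h'
  · rw [max_eq_right h', mul_zero]
    positivity
  rw [max_eq_left h']
  rcases le_total a 0 with h'' | h''
  · rw [max_eq_right h'']
    nlinarith
  rw [max_eq_left h'']
  have h1 : s * ((s + t) * a') ≤ s * (s * a + (s + t) * η) := by
    nlinarith [mul_le_mul_of_nonneg_left h (by positivity : 0 ≤ s + t),
      mul_nonneg (mul_nonneg ht ht) h'']
  exact le_of_mul_le_mul_left h1 hs

/-- A form of Kronecker's lemma, by dominated convergence for series: for `j < k` the weight
`s (j + 1) / s k` is at most `1`, and it tends to `0` as `k → ∞`. -/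
theorem tendsto_weighted_sum_div_zero {s η : ℕ → ℝ} (hs0 : ∀ k, 0 < s k) (hs : Monotone s)
    (hs_top : Tendsto s atTop atTop) (hη : ∀ k, 0 ≤ η k) (hη_sum : Summable η) :
    Tendsto (fun k => (∑ j ∈ Finset.range k, s (j + 1) * η j) / s k) atTop (𝓝 0) := by
  have h := tendsto_tsum_of_dominated_convergence (𝓕 := atTop)
    (f := fun k j => if j < k then s (j + 1) * η j / s k else 0) (g := fun _ => 0) hη_sum
    (fun j => by
      refine ((tendsto_const_nhds (x := s (j + 1) * η j)).div_atTop hs_top).congr' ?_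
      filter_upwards [eventually_gt_atTop j] with k hk
      simp [hk])
    (Eventually.of_forall fun k j => by
      split_ifs with hjk
      · have h1 := hs (Nat.succ_le_of_lt hjk)
        have h2 : 0 ≤ s (j + 1) * η j / s k :=
          div_nonneg (mul_nonneg (hs0 _).le (hη j)) (hs0 k).le
        rw [Real.norm_of_nonneg h2, div_le_iff₀ (hs0 k), mul_comm]
        exact mul_le_mul_of_nonneg_left h1 (hη j)
      · simpa using hη j)
  simp only [tsum_zero] at h
  refine h.congr fun k => ?_
  rw [tsum_eq_sum (s := Finset.range k) (fun j hj => if_neg (by simpa using hj)), Finset.sum_div]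
  exact Finset.sum_congr rfl fun j hj => if_pos (Finset.mem_range.1 hj)

/-! ### Uniform convergence of the greedy iterates -/

theorem IsGreedyBoosting.dualBound {S : Set (X → ℝ)} {A : (X → ℝ) → ℝ} {f₀ : X → ℝ} {ε h : ℕ → ℝ}
    {Λ : ℕ → Set ℝ} {K : ℕ} {f : ℕ → X → ℝ} {r : ℝ} (hf : IsGreedyBoosting S A f₀ ε Λ K f)
    (hΛ : ∀ k, ∀ a ∈ Λ k, |a| ≤ h k) (hf₀ : DualBound S f₀ r) {k : ℕ} (hk : k ≤ K) :
    DualBound S (f k) (r + ∑ j ∈ Finset.range k, h j) := by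
  induction k with
  | zero => simpa [hf.1] using hf₀
  | succ k ih =>
    obtain ⟨α, hα, g, hg, he, -⟩ := hf.2 k hk
    rw [he, Finset.sum_range_succ, ← add_assoc]
    exact (ih (by omega)).add ((DualBound.smul_of_mem hg α).mono (hΛ k α hα))

theorem IsGreedyBoosting.mem_span {S : Set (X → ℝ)} {A : (X → ℝ) → ℝ} {f₀ : X → ℝ} {ε : ℕ → ℝ}
    {Λ : ℕ → Set ℝ} {K : ℕ} {f : ℕ → X → ℝ} (hf : IsGreedyBoosting S A f₀ ε Λ K f)
    (hf₀ : f₀ ∈ Submodule.span ℝ S) {k : ℕ} (hk : k ≤ K) : f k ∈ Submodule.span ℝ S := by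
  induction k with
  | zero => rw [hf.1]; exact hf₀
  | succ k ih =>
    obtain ⟨α, hα, g, hg, he, -⟩ := hf.2 k hk
    rw [he]
    exact add_mem (ih (by omega)) (Submodule.smul_mem _ _ (Submodule.subset_span hg))

theorem IsGreedyBoosting.objective_le {S : Set (X → ℝ)} {A : (X → ℝ) → ℝ} {f₀ : X → ℝ} {ε : ℕ → ℝ}
    {Λ : ℕ → Set ℝ} {K : ℕ} {f : ℕ → X → ℝ} (hf : IsGreedyBoosting S A f₀ ε Λ K f)
    (hΛ : ∀ k, (0 : ℝ) ∈ Λ k) {k : ℕ} (hk : k ≤ K) :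
    A (f k) ≤ A f₀ + ∑ j ∈ Finset.range k, ε j := by
  induction k with
  | zero => simp [hf.1]
  | succ k ih =>
    obtain ⟨α, hα, g, hg, he, h⟩ := hf.2 k hk
    have h1 := h 0 (hΛ k) g hg
    rw [zero_smul, add_zero, ← he] at h1
    rw [Finset.sum_range_succ]
    linarith [ih (by omega)]

/-- After `k` greedy steps the empirical risk exceeds that of a fixed competitor `f'` by at most
`bnd k`, where `bnd` is a null sequence that depends neither on the sample nor on its size. -/
theorem exists_empRisk_greedy_le {S : Set (X → ℝ)} (hS_bdd : ∀ g ∈ S, ∀ x, |g x| ≤ 1)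
    (hS_neg : ∀ g ∈ S, -g ∈ S) (L : Loss) {f₀ f' : X → ℝ} (hf₀ : f₀ ∈ Submodule.span ℝ S)
    (hf' : f' ∈ Submodule.span ℝ S)
    {ε : ℕ → ℝ} (hε_nonneg : ∀ k, 0 ≤ ε k) (hε_sum : Summable ε)
    {Λ : ℕ → Set ℝ} (hΛ_closed : ∀ k, IsClosed (Λ k)) (hΛ_zero : ∀ k, (0 : ℝ) ∈ Λ k)
    (hΛ_neg : ∀ k, ∀ a ∈ Λ k, -a ∈ Λ k) {h : ℕ → ℝ} (hh_sup : ∀ k, IsLUB (Λ k) (h k))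
    (hh_sum : Tendsto (fun n => ∑ k ∈ Finset.range n, h k) atTop atTop)
    (hh_sq : Summable fun k => h k ^ 2) :
    ∃ bnd : ℕ → ℝ, Tendsto bnd atTop (𝓝 0) ∧ ∀ m : ℕ, 0 < m → ∀ z : Fin m → X × ℝ,
      (∀ i, (z i).2 = 1 ∨ (z i).2 = -1) → ∀ K f,
        IsGreedyBoosting S (empObjective L z) f₀ ε Λ K f →
          empRisk z L.phi (f K) ≤ empRisk z L.phi f' + bnd K := by
  obtain ⟨r₀, hr₀, hf₀r⟩ := exists_dualBound_of_mem_span hf₀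
  obtain ⟨r', hr', hf'r⟩ := exists_dualBound_of_mem_span hf'
  have hh_mem : ∀ k, h k ∈ Λ k := fun k => (hh_sup k).mem_of_isClosed ⟨0, hΛ_zero k⟩ (hΛ_closed k)
  have hh0 : ∀ k, 0 ≤ h k := fun k => (hh_sup k).1 (hΛ_zero k)
  have hΛ_abs : ∀ k, ∀ a ∈ Λ k, |a| ≤ h k := fun k a ha =>
    abs_le'.2 ⟨(hh_sup k).1 ha, (hh_sup k).1 (hΛ_neg k a ha)⟩
  obtain ⟨H, hH⟩ : ∃ H, ∀ k, h k ≤ H := by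
    refine ⟨Real.sqrt (∑' k, h k ^ 2), fun k => Real.le_sqrt_of_sq_le ?_⟩
    exact hh_sq.le_tsum k fun j _ => sq_nonneg _
  have hH0 : 0 ≤ H := (hh0 0).trans (hH 0)
  obtain ⟨d, C, hC, hd⟩ := L.exists_quadratic_bounds hH0
  obtain ⟨B₀, hB₀⟩ := (isCompact_Icc (a := -r₀) (b := r₀)).exists_bound_of_continuousOn
    L.phi_continuous.continuousOn
  obtain ⟨B, hB⟩ := L.exists_bound_of_psi_le B₀ (∑' k, ε k)
  obtain ⟨Kψ, hKψ, hψ⟩ := L.exists_le_add_of_psi_le B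
  set C' := C * (max B 0 + 1) with hC'
  have hC'0 : 0 ≤ C' := mul_nonneg hC (by positivity)
  -- `s k` bounds the 1-norm of `f' - f k`; the summand `1` keeps it positive.
  set s : ℕ → ℝ := fun k => r' + r₀ + 1 + ∑ j ∈ Finset.range k, h j with hs
  set η : ℕ → ℝ := fun k => Kψ * ε k + C' * h k ^ 2 with hη
  have hη0 : ∀ k, 0 ≤ η k := fun k =>
    add_nonneg (mul_nonneg hKψ (hε_nonneg k)) (mul_nonneg hC'0 (sq_nonneg _))
  have hη_sum : Summable η := (hε_sum.mul_left Kψ).add (hh_sq.mul_left C')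
  have hs_succ : ∀ k, s (k + 1) = s k + h k := fun k => by
    simp only [hs, Finset.sum_range_succ]; ring
  have hs_pos : ∀ k, 0 < s k := fun k => by
    have := Finset.sum_nonneg (s := Finset.range k) fun j _ => hh0 j
    simp only [hs]; linarith
  have hs_mono : Monotone s := monotone_nat_of_le_succ fun k => by
    rw [hs_succ]; linarith [hh0 k]
  have hs_top : Tendsto s atTop atTop := tendsto_atTop_add_const_left _ _ hh_sum
  refine ⟨fun k => s 0 * B₀ / s k + (∑ j ∈ Finset.range k, s (j + 1) * η j) / s k, ?_, ?_⟩
  · simpa using (tendsto_const_nhds.div_atTop hs_top).add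
      (tendsto_weighted_sum_div_zero hs_pos hs_mono hs_top hη0 hη_sum)
  intro m hm z hz K f hf
  have hpos : ∀ f g : X → ℝ, L = .exponential →
      0 < empRisk z L.phi f ∧ 0 < empRisk z L.phi g := fun f g hL =>
    ⟨empRisk_pos hm z hL f, empRisk_pos hm z hL g⟩
  have hQ₀ : empRisk z L.phi f₀ ≤ B₀ := by
    refine empRisk_le hm z fun i => (le_abs_self _).trans (hB₀ _ ?_)
    rw [Set.mem_Icc, ← abs_le, abs_mul_label (hz i)]
    exact hf₀r.abs_apply_le hS_bdd _
  have hQB : ∀ k ≤ K, empRisk z L.phi (f k) ≤ B := fun k hk => by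
    refine hB _ _ (empRisk_nonneg z L _) (empRisk_nonneg z L f₀) (hpos _ _) hQ₀ ?_
    refine (hf.objective_le hΛ_zero hk).trans ?_
    exact add_le_add_right (hε_sum.sum_le_tsum _ fun j _ => hε_nonneg j) _
  have key : ∀ k ≤ K, s k * max (empRisk z L.phi (f k) - empRisk z L.phi f') 0 ≤
      s 0 * B₀ + ∑ j ∈ Finset.range k, s (j + 1) * η j := by
    intro k
    induction k with
    | zero =>
      intro _
      rw [hf.1, Finset.sum_range_zero, add_zero]
      have h1 := empRisk_nonneg z L f'
      have h2 := empRisk_nonneg z L f₀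
      exact mul_le_mul_of_nonneg_left (max_le (by linarith) (by linarith)) (hs_pos 0).le
    | succ k ih =>
      intro hk
      obtain ⟨α, hα, g₀, hg₀, he, hmin⟩ := hf.2 k hk
      rw [← he] at hmin
      have hQ : ∀ α' ∈ Λ k, ∀ g ∈ S,
          empRisk z L.phi (f (k + 1)) ≤ empRisk z L.phi (f k + α' • g) + Kψ * ε k :=
        fun α' hα' g hg => hψ _ _ _ (empRisk_nonneg z L _) (empRisk_nonneg z L _) (hpos _ _)
          (hQB _ hk) (hε_nonneg k) (hmin α' hα' g hg)
      have hstay := hQ 0 (hΛ_zero k) g₀ hg₀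
      rw [zero_smul, add_zero] at hstay
      have hdual : DualBound S (f' - f k) (s k) := by
        rw [sub_eq_add_neg]
        refine (hf'r.add (hf.dualBound hΛ_abs hf₀r (by omega)).neg).mono ?_
        simp only [hs]; linarith
      have hstep := excess_le_of_greedy_step ⟨g₀, hg₀⟩ hS_bdd hS_neg hm z hz hC L.phi_nonneg hd
        (hh0 k) (hH k) ((hQB k (by omega)).trans (le_max_left B 0)) (hQ (h k) (hh_mem k)) hdual
      rw [add_sub_cancel] at hstep
      have h1 := mul_excess_le (hs_pos k) (hh0 k) (hη0 k)
        (a := empRisk z L.phi (f k) - empRisk z L.phi f')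
        (a' := empRisk z L.phi (f (k + 1)) - empRisk z L.phi f')
        (by
          have := mul_nonneg hC'0 (sq_nonneg (h k))
          simp only [hη]; linarith)
        (by rw [sub_sub_sub_cancel_right]; exact hstep)
      rw [← hs_succ] at h1
      rw [Finset.sum_range_succ]
      linarith [ih (by omega)]
  have h1 := key K le_rfl
  rw [← le_div_iff₀' (hs_pos K), add_div] at h1
  linarith [le_max_left (empRisk z L.phi (f K) - empRisk z L.phi f') 0]

/-! ### The contraction principle for Rademacher averages -/

section Contraction

variable {ι T : Type*} [Fintype ι]

theorem bddAbove_range_sign_sum {u : ι → T → ℝ} (hu : ∀ i, ∃ B, ∀ t, |u i t| ≤ B) (σ : ι → ℤˣ) :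
    BddAbove (Set.range fun t => ∑ i, ((σ i : ℤ) : ℝ) * u i t) := by
  choose B hB using hu
  refine ⟨∑ i, B i, ?_⟩
  rintro _ ⟨t, rfl⟩
  refine Finset.sum_le_sum fun i _ => ?_
  rcases Int.units_eq_one_or (σ i) with h | h <;> simp only [h] <;> push_cast
  · linarith [le_abs_self (u i t), hB i t]
  · linarith [neg_abs_le (u i t), hB i t]

/-- Replacing the functions in one coordinate by functions with larger increments increases the
Rademacher average: the two sign vectors that differ in this coordinate only are treated
together. -/
theorem sum_iSup_sign_sum_le_update [DecidableEq ι] [Nonempty T] {u : ι → T → ℝ}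
    (hu : ∀ i, ∃ B, ∀ t, |u i t| ≤ B) (j : ι) {v : T → ℝ} (hv : ∃ B, ∀ t, |v t| ≤ B)
    (h : ∀ s t, |u j s - u j t| ≤ |v s - v t|) :
    ∑ σ : ι → ℤˣ, ⨆ t, ∑ i, ((σ i : ℤ) : ℝ) * u i t ≤
      ∑ σ : ι → ℤˣ, ⨆ t, ∑ i, ((σ i : ℤ) : ℝ) * Function.update u j v i t := by
  set F : (ι → ℤˣ) → ℝ := fun σ => ⨆ t, ∑ i, ((σ i : ℤ) : ℝ) * u i t with hF
  set G : (ι → ℤˣ) → ℝ := fun σ => ⨆ t, ∑ i, ((σ i : ℤ) : ℝ) * Function.update u j v i t with hG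
  have hu' : ∀ i, ∃ B, ∀ t, |Function.update u j v i t| ≤ B := fun i => by
    rcases eq_or_ne i j with rfl | hij
    · simpa using hv
    · simpa [hij] using hu i
  let flip : Equiv.Perm (ι → ℤˣ) := Function.Involutive.toPerm
    (fun σ => Function.update σ j (-σ j)) fun σ => by simp
  have hflip_apply : ∀ σ, flip σ = Function.update σ j (-σ j) := fun _ => rfl
  have hflip : ∀ K : (ι → ℤˣ) → ℝ, ∑ σ, K σ = (∑ σ, (K σ + K (flip σ))) / 2 := fun K => by
    rw [Finset.sum_add_distrib, Equiv.sum_comp flip K]; ring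
  change ∑ σ, F σ ≤ ∑ σ, G σ
  rw [hflip F, hflip G]
  refine div_le_div_of_nonneg_right (Finset.sum_le_sum fun σ _ => ?_) zero_le_two
  set R : T → ℝ := fun t => ∑ i ∈ Finset.univ.erase j, ((σ i : ℤ) : ℝ) * u i t with hR
  have split : ∀ (w : ι → T → ℝ) (t : T), ∑ i, ((σ i : ℤ) : ℝ) * w i t =
      (∑ i ∈ Finset.univ.erase j, ((σ i : ℤ) : ℝ) * w i t) + ((σ j : ℤ) : ℝ) * w j t :=
    fun w t => (Finset.sum_erase_add _ _ (Finset.mem_univ j)).symm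
  have split' : ∀ (w : ι → T → ℝ) (t : T), ∑ i, ((flip σ i : ℤ) : ℝ) * w i t =
      (∑ i ∈ Finset.univ.erase j, ((σ i : ℤ) : ℝ) * w i t) - ((σ j : ℤ) : ℝ) * w j t :=
    fun w t => by
      rw [← Finset.sum_erase_add _ _ (Finset.mem_univ j), sub_eq_add_neg]
      congr 1
      · refine Finset.sum_congr rfl fun i hi => ?_
        rw [hflip_apply, Function.update_of_ne (Finset.ne_of_mem_erase hi)]
      · rw [hflip_apply, Function.update_self]; push_cast; ring
  have hRu : ∀ t, ∑ i ∈ Finset.univ.erase j, ((σ i : ℤ) : ℝ) * Function.update u j v i t = R t :=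
    fun t => Finset.sum_congr rfl fun i hi => by
      rw [Function.update_of_ne (Finset.ne_of_mem_erase hi)]
  have hG1 : ∀ t, R t + ((σ j : ℤ) : ℝ) * v t ≤ G σ := fun t => by
    have := le_ciSup (bddAbove_range_sign_sum hu' σ) t
    rwa [split, hRu, Function.update_self] at this
  have hG2 : ∀ t, R t - ((σ j : ℤ) : ℝ) * v t ≤ G (flip σ) := fun t => by
    have := le_ciSup (bddAbove_range_sign_sum hu' (flip σ)) t
    rwa [split', hRu, Function.update_self] at this
  have main : ∀ s t, R s + ((σ j : ℤ) : ℝ) * u j s + (R t - ((σ j : ℤ) : ℝ) * u j t) ≤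
      G σ + G (flip σ) := fun s t => by
    have h1 := hG1 s; have h2 := hG2 s; have h3 := hG1 t; have h4 := hG2 t
    have h5 := h s t
    have h6 := le_abs_self (u j s - u j t)
    have h7 := neg_abs_le (u j s - u j t)
    rcases Int.units_eq_one_or (σ j) with hσ | hσ <;> simp only [hσ] at h1 h2 h3 h4 ⊢ <;>
      push_cast at h1 h2 h3 h4 ⊢ <;> rcases abs_cases (v s - v t) with ⟨h8, _⟩ | ⟨h8, _⟩ <;>
      linarith
  have hFle : F σ ≤ G σ + G (flip σ) - F (flip σ) := by
    refine ciSup_le fun s => ?_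
    rw [le_sub_comm]
    refine ciSup_le fun t => ?_
    rw [split, split']
    linarith [main s t]
  linarith

/-- The one-sided contraction principle of Ledoux and Talagrand. -/
theorem sum_iSup_sign_sum_le [DecidableEq ι] [Nonempty T] {u v : ι → T → ℝ}
    (hu : ∀ i, ∃ B, ∀ t, |u i t| ≤ B) (hv : ∀ i, ∃ B, ∀ t, |v i t| ≤ B)
    (h : ∀ i s t, |u i s - u i t| ≤ |v i s - v i t|) :
    ∑ σ : ι → ℤˣ, ⨆ t, ∑ i, ((σ i : ℤ) : ℝ) * u i t ≤
      ∑ σ : ι → ℤˣ, ⨆ t, ∑ i, ((σ i : ℤ) : ℝ) * v i t := by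
  have key : ∀ A : Finset ι, ∑ σ : ι → ℤˣ, ⨆ t, ∑ i, ((σ i : ℤ) : ℝ) * u i t ≤
      ∑ σ : ι → ℤˣ, ⨆ t, ∑ i, ((σ i : ℤ) : ℝ) * A.piecewise v u i t := by
    intro A
    induction A using Finset.induction_on with
    | empty => simp
    | insert j A hj ih =>
      rw [Finset.piecewise_insert]
      refine ih.trans (sum_iSup_sign_sum_le_update (fun i => ?_) j (hv j) fun s t => ?_)
      · by_cases hi : i ∈ A
        · simpa [hi] using hv i
        · simpa [hi] using hu i
      · simpa [hj] using h j s t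
  simpa using key Finset.univ

end Contraction

/-! ### Rademacher complexity of the span -/

/-- The signed sample average `c ↦ (1/m) ∑ σ i * c (x i)` as a linear functional. -/
def signedMean {m : ℕ} (σ : Fin m → ℤˣ) (x : Fin m → X) : (X → ℝ) →ₗ[ℝ] ℝ :=
  (1 / (m : ℝ)) • ∑ i, ((σ i : ℤ) : ℝ) • LinearMap.proj (x i)

theorem signedMean_apply {m : ℕ} (σ : Fin m → ℤˣ) (x : Fin m → X) (c : X → ℝ) :
    signedMean σ x c = (1 / (m : ℝ)) * ∑ i, ((σ i : ℤ) : ℝ) * c (x i) := by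
  simp [signedMean, LinearMap.sum_apply]

theorem abs_sign_mul (e : ℤˣ) (a : ℝ) : |((e : ℤ) : ℝ) * a| = |a| := by
  rcases Int.units_eq_one_or e with h | h <;> simp [h]

theorem abs_signedMean_le {m : ℕ} (σ : Fin m → ℤˣ) (x : Fin m → X) {c : X → ℝ}
    (hc : ∀ x, |c x| ≤ 1) : |signedMean σ x c| ≤ 1 := by
  rw [signedMean_apply, abs_mul, abs_of_nonneg (by positivity : 0 ≤ 1 / (m : ℝ)), one_div]
  have h1 : |∑ i, ((σ i : ℤ) : ℝ) * c (x i)| ≤ m := by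
    refine (Finset.abs_sum_le_sum_abs _ _).trans ?_
    refine (Finset.sum_le_sum fun i _ => (abs_sign_mul (σ i) (c (x i))).trans_le (hc _)).trans ?_
    simp
  exact inv_mul_le_one_of_le₀ h1 (by positivity)

section Sup

variable {S : Set (X → ℝ)}

theorem bddAbove_range_signedMean (hS_bdd : ∀ g ∈ S, ∀ x, |g x| ≤ 1) {m : ℕ} (σ : Fin m → ℤˣ)
    (x : Fin m → X) : BddAbove (Set.range fun g : S => signedMean σ x g) :=
  ⟨1, by rintro _ ⟨g, rfl⟩; exact (abs_le.1 (abs_signedMean_le σ x (hS_bdd g g.2))).2⟩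

theorem abs_signedMean_le_iSup (hS_bdd : ∀ g ∈ S, ∀ x, |g x| ≤ 1) (hS_neg : ∀ g ∈ S, -g ∈ S)
    {m : ℕ} (σ : Fin m → ℤˣ) (x : Fin m → X) {g : X → ℝ} (hg : g ∈ S) :
    |signedMean σ x g| ≤ ⨆ g : S, signedMean σ x g := by
  refine abs_le'.2 ⟨le_ciSup (bddAbove_range_signedMean hS_bdd σ x) ⟨g, hg⟩, ?_⟩
  rw [← map_neg]
  exact le_ciSup (bddAbove_range_signedMean hS_bdd σ x) ⟨-g, hS_neg g hg⟩

theorem empRademacher_eq {m : ℕ} (x : Fin m → X) :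
    empRademacher S x = (1 / (2 : ℝ) ^ m) * ∑ σ : Fin m → ℤˣ, ⨆ g : S, signedMean σ x g := by
  simp only [empRademacher, signedMean_apply]

theorem two_pow_mul_empRademacher {m : ℕ} (x : Fin m → X) :
    (2 : ℝ) ^ m * empRademacher S x = ∑ σ : Fin m → ℤˣ, ⨆ g : S, signedMean σ x g := by
  rw [empRademacher_eq, ← mul_assoc, mul_one_div_cancel (by positivity), one_mul]

theorem empRademacher_nonneg (hS_bdd : ∀ g ∈ S, ∀ x, |g x| ≤ 1) (hS_neg : ∀ g ∈ S, -g ∈ S)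
    {m : ℕ} (x : Fin m → X) : 0 ≤ empRademacher S x := by
  rw [empRademacher_eq]
  refine mul_nonneg (by positivity) (Finset.sum_nonneg fun σ _ => ?_)
  rcases isEmpty_or_nonempty S with h | ⟨⟨g, hg⟩⟩
  · simp
  · exact (abs_nonneg _).trans (abs_signedMean_le_iSup hS_bdd hS_neg σ x hg)

theorem empRademacher_le_one (hS_bdd : ∀ g ∈ S, ∀ x, |g x| ≤ 1) {m : ℕ} (x : Fin m → X) :
    empRademacher S x ≤ 1 := by
  have h : ∑ σ : Fin m → ℤˣ, ⨆ g : S, signedMean σ x g ≤ ∑ _σ : Fin m → ℤˣ, 1 :=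
    Finset.sum_le_sum fun σ _ => Real.iSup_le
      (fun g => (abs_le.1 (abs_signedMean_le σ x (hS_bdd g g.2))).2) zero_le_one
  rw [empRademacher_eq, one_div, inv_mul_le_iff₀ (by positivity)]
  simpa using h

/-- The contraction principle for the losses `φ (f x * y)`, with `f` ranging over `b` times the
absolutely convex hull of `S`.  The maximizer may be replaced by an arbitrary choice `f σ`. -/
theorem sum_sign_sum_le_empRademacher (hS : S.Nonempty) (hS_bdd : ∀ g ∈ S, ∀ x, |g x| ≤ 1)
    (hS_neg : ∀ g ∈ S, -g ∈ S) {m : ℕ} (z : Fin m → X × ℝ)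
    (hz : ∀ i, (z i).2 = 1 ∨ (z i).2 = -1) {φ : ℝ → ℝ} {b γ : ℝ}
    (hφ : ∀ u v : ℝ, |u| ≤ b → |v| ≤ b → |φ u - φ v| ≤ γ * |u - v|)
    {f : (Fin m → ℤˣ) → X → ℝ} (hf : ∀ σ, DualBound S (f σ) b) :
    ∑ σ : Fin m → ℤˣ, ∑ i, ((σ i : ℤ) : ℝ) * (1 / (m : ℝ) * φ (f σ (z i).1 * (z i).2)) ≤
      |γ| * b * (2 ^ m * empRademacher S fun i => (z i).1) := by
  let T := {f : X → ℝ // DualBound S f b}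
  have : Nonempty T := ⟨⟨f 1, hf 1⟩⟩
  have hT : ∀ (t : T) (x : X), |t.1 x| ≤ b := fun t x => t.2.abs_apply_le hS_bdd x
  have hm0 : 0 ≤ 1 / (m : ℝ) := by positivity
  let u : Fin m → T → ℝ := fun i t => 1 / (m : ℝ) * φ (t.1 (z i).1 * (z i).2)
  let v : Fin m → T → ℝ := fun i t => 1 / (m : ℝ) * (γ * t.1 (z i).1)
  have hTz : ∀ (t : T) i, |t.1 (z i).1 * (z i).2| ≤ b := fun t i => by
    rw [abs_mul_label (hz i)]; exact hT t _
  have huv : ∀ i s t, |u i s - u i t| ≤ |v i s - v i t| := fun i s t => by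
    simp only [u, v, ← mul_sub, abs_mul]
    gcongr
    refine (hφ _ _ (hTz s i) (hTz t i)).trans ?_
    rw [← sub_mul, abs_mul_label (hz i)]
    gcongr
    exact le_abs_self γ
  have hv : ∀ i, ∃ B, ∀ t, |v i t| ≤ B := fun i => ⟨1 / (m : ℝ) * (|γ| * b), fun t => by
    simp only [v]
    rw [abs_mul, abs_mul, abs_of_nonneg hm0]
    gcongr
    exact hT t _⟩
  have hu : ∀ i, ∃ B, ∀ t, |u i t| ≤ B := fun i => by
    obtain ⟨B, hB⟩ := hv i
    let t₀ : T := ⟨f 1, hf 1⟩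
    refine ⟨B + B + |u i t₀|, fun t => ?_⟩
    have h1 := huv i t t₀
    have h2 := abs_sub (v i t) (v i t₀)
    have h3 := abs_add_le (u i t - u i t₀) (u i t₀)
    rw [sub_add_cancel] at h3
    linarith [hB t, hB t₀]
  calc ∑ σ : Fin m → ℤˣ, ∑ i, ((σ i : ℤ) : ℝ) * (1 / (m : ℝ) * φ (f σ (z i).1 * (z i).2))
      ≤ ∑ σ : Fin m → ℤˣ, ⨆ t, ∑ i, ((σ i : ℤ) : ℝ) * u i t :=
        Finset.sum_le_sum fun σ _ => le_ciSup (bddAbove_range_sign_sum hu σ) (⟨f σ, hf σ⟩ : T)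
    _ ≤ ∑ σ : Fin m → ℤˣ, ⨆ t, ∑ i, ((σ i : ℤ) : ℝ) * v i t := sum_iSup_sign_sum_le hu hv huv
    _ ≤ ∑ σ : Fin m → ℤˣ, |γ| * b * ⨆ g : S, signedMean σ (fun i => (z i).1) g := by
        refine Finset.sum_le_sum fun σ _ => ciSup_le fun t => ?_
        have e : ∑ i, ((σ i : ℤ) : ℝ) * v i t = γ * signedMean σ (fun i => (z i).1) t.1 := by
          rw [signedMean_apply, Finset.mul_sum, Finset.mul_sum]
          exact Finset.sum_congr rfl fun i _ => by simp only [v]; ring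
        have hsup := fun g hg => abs_signedMean_le_iSup hS_bdd hS_neg σ (fun i => (z i).1)
          (g := g) hg
        obtain ⟨g, hg⟩ := hS
        have h1 := t.2 (signedMean σ fun i => (z i).1) _ ((abs_nonneg _).trans (hsup g hg)) hsup
        rw [e, mul_assoc]
        refine (le_abs_self _).trans ?_
        rw [abs_mul]
        gcongr
    _ = _ := by rw [← Finset.mul_sum, two_pow_mul_empRademacher]

end Sup

/-! ### Symmetrization -/

theorem exists_abs_le_of_abs_le {φ : ℝ → ℝ} (hφ : Continuous φ) (b : ℝ) :
    ∃ C, ∀ a, |a| ≤ b → |φ a| ≤ C := by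
  obtain ⟨C, hC⟩ := (isCompact_Icc (a := -b) (b := b)).exists_bound_of_continuousOn
    hφ.continuousOn
  exact ⟨C, fun a ha => hC a (abs_le.1 ha)⟩

theorem abs_empRisk_le {m : ℕ} (hm : 0 < m) (z : Fin m → X × ℝ)
    (hz : ∀ i, (z i).2 = 1 ∨ (z i).2 = -1) {φ : ℝ → ℝ} {b C : ℝ}
    (hC : ∀ a, |a| ≤ b → |φ a| ≤ C) {f : X → ℝ} (hf : ∀ x, |f x| ≤ b) :
    |empRisk z φ f| ≤ C := by
  have h : ∀ i, |φ (f (z i).1 * (z i).2)| ≤ C := fun i =>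
    hC _ ((abs_mul_label (hz i)).trans_le (hf _))
  refine abs_le'.2 ⟨empRisk_le hm z fun i => (abs_le'.1 (h i)).1, ?_⟩
  have h1 := empRisk_le hm z (φ := fun a => -φ a) (f := f) fun i => (abs_le'.1 (h i)).2
  simpa [empRisk] using h1

theorem integral_comp_measurePreserving {α β : Type*} [MeasurableSpace α] [MeasurableSpace β]
    {μ : Measure α} {ν : Measure β} {e : α → β} (he : MeasurePreserving e μ ν) {f : β → ℝ}
    (hf : AEStronglyMeasurable f ν) : ∫ a, f (e a) ∂μ = ∫ b, f b ∂ν := by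
  rw [← he.map_eq, integral_map he.measurable.aemeasurable]
  rwa [he.map_eq]

variable [MeasurableSpace X] {D : Measure (X × ℝ)}

/-- The setting of the symmetrization argument: a jointly measurable estimator `F` that, almost
surely, takes its values in `b` times the absolutely convex hull of `S`. -/
structure IsBoundedEstimator (D : Measure (X × ℝ)) (S : Set (X → ℝ)) (b : ℝ) {m : ℕ}
    (F : (Fin m → X × ℝ) → X → ℝ) : Prop where
  measurable : Measurable fun q : (Fin m → X × ℝ) × X => F q.1 q.2
  dualBound : ∀ᵐ z ∂(sampleLaw D m), DualBound S (F z) b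

theorem IsBoundedEstimator.measurable_empRisk {S : Set (X → ℝ)} {b : ℝ} {m : ℕ}
    {F : (Fin m → X × ℝ) → X → ℝ} {φ : ℝ → ℝ} (hF : IsBoundedEstimator D S b F) (hφ : Continuous φ) :
    Measurable fun q : (Fin m → X × ℝ) × (Fin m → X × ℝ) => empRisk q.2 φ (F q.1) := by
  refine Measurable.const_mul (Finset.measurable_sum _ fun i _ => hφ.measurable.comp ?_) _
  have hi : Measurable fun q : (Fin m → X × ℝ) × (Fin m → X × ℝ) => q.2 i :=
    (measurable_pi_apply i).comp measurable_snd
  exact (hF.measurable.comp (measurable_fst.prodMk (measurable_fst.comp hi))).mul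
    (measurable_snd.comp hi)

variable [IsProbabilityMeasure D]

instance isProbabilityMeasure_sampleLaw (m : ℕ) : IsProbabilityMeasure (sampleLaw D m) := by
  unfold sampleLaw; infer_instance

theorem measurePreserving_sample_eval (m : ℕ) (i : Fin m) :
    MeasurePreserving (fun z : Fin m → X × ℝ => z i) (sampleLaw D m) D :=
  measurePreserving_eval (fun _ : Fin m => D) i

theorem ae_sample_label (hY : ∀ᵐ z ∂D, z.2 = 1 ∨ z.2 = -1) (m : ℕ) :
    ∀ᵐ z ∂(sampleLaw D m), ∀ i, (z i).2 = 1 ∨ (z i).2 = -1 :=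
  ae_all_iff.2 fun i => (measurePreserving_sample_eval m i).quasiMeasurePreserving.ae hY

/-- The empirical risk of a fixed function is an unbiased estimate of its risk. -/
theorem integral_empRisk {m : ℕ} (hm : 0 < m) {φ : ℝ → ℝ} {f : X → ℝ}
    (hf : Integrable (fun z : X × ℝ => φ (f z.1 * z.2)) D) :
    ∫ z, empRisk z φ f ∂(sampleLaw D m) = risk D φ f := by
  have hm' : (m : ℝ) ≠ 0 := by exact_mod_cast hm.ne'
  have hi : ∀ i : Fin m, Integrable (fun z : Fin m → X × ℝ => φ (f (z i).1 * (z i).2))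
      (sampleLaw D m) := fun i =>
    (measurePreserving_sample_eval m i).integrable_comp_of_integrable hf
  simp only [empRisk, integral_const_mul]
  rw [integral_finsetSum _ fun i _ => hi i]
  have : ∀ i : Fin m, ∫ z : Fin m → X × ℝ, φ (f (z i).1 * (z i).2) ∂(sampleLaw D m) =
      risk D φ f := fun i =>
    integral_comp_measurePreserving (measurePreserving_sample_eval m i) hf.aestronglyMeasurable
  simp only [this, Finset.sum_const, Finset.card_univ, Fintype.card_fin, nsmul_eq_mul]
  field_simp

theorem integrable_loss (hY : ∀ᵐ z ∂D, z.2 = 1 ∨ z.2 = -1) {φ : ℝ → ℝ} (hφ : Continuous φ)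
    {f : X → ℝ} (hf : Measurable f) {b : ℝ} (hb : ∀ x, |f x| ≤ b) :
    Integrable (fun z : X × ℝ => φ (f z.1 * z.2)) D := by
  obtain ⟨C, hC⟩ := exists_abs_le_of_abs_le hφ b
  refine Integrable.of_bound (C := C) (hφ.measurable.comp
    ((hf.comp measurable_fst).mul measurable_snd)).aestronglyMeasurable ?_
  filter_upwards [hY] with z hz
  exact hC _ ((abs_mul_label hz).trans_le (hb _))

namespace IsBoundedEstimator

variable {S : Set (X → ℝ)} {b : ℝ} {m : ℕ} {F : (Fin m → X × ℝ) → X → ℝ} {φ : ℝ → ℝ}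

theorem integrable_empRisk (hF : IsBoundedEstimator D S b F) (hm : 0 < m)
    (hY : ∀ᵐ z ∂D, z.2 = 1 ∨ z.2 = -1) (hS_bdd : ∀ g ∈ S, ∀ x, |g x| ≤ 1) (hφ : Continuous φ) :
    Integrable (fun z => empRisk z φ (F z)) (sampleLaw D m) := by
  obtain ⟨C, hC⟩ := exists_abs_le_of_abs_le hφ b
  refine Integrable.of_bound (C := C) ((hF.measurable_empRisk hφ).comp
    (measurable_id.prodMk measurable_id)).aestronglyMeasurable ?_
  filter_upwards [ae_sample_label hY m, hF.dualBound] with z hz hd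
  exact abs_empRisk_le hm z hz hC (hd.abs_apply_le hS_bdd)

theorem integrable_empRisk_prod (hF : IsBoundedEstimator D S b F) (hm : 0 < m)
    (hY : ∀ᵐ z ∂D, z.2 = 1 ∨ z.2 = -1) (hS_bdd : ∀ g ∈ S, ∀ x, |g x| ≤ 1) (hφ : Continuous φ) :
    Integrable (fun q : (Fin m → X × ℝ) × (Fin m → X × ℝ) => empRisk q.2 φ (F q.1))
      ((sampleLaw D m).prod (sampleLaw D m)) := by
  obtain ⟨C, hC⟩ := exists_abs_le_of_abs_le hφ b
  refine Integrable.of_bound (C := C) (hF.measurable_empRisk hφ).aestronglyMeasurable ?_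
  filter_upwards [Measure.quasiMeasurePreserving_snd.ae (ae_sample_label hY m),
    Measure.quasiMeasurePreserving_fst.ae hF.dualBound] with q hz hd
  exact abs_empRisk_le hm q.2 hz hC (hd.abs_apply_le hS_bdd)

theorem ae_integral_empRisk_eq (hF : IsBoundedEstimator D S b F) (hm : 0 < m)
    (hY : ∀ᵐ z ∂D, z.2 = 1 ∨ z.2 = -1) (hS_bdd : ∀ g ∈ S, ∀ x, |g x| ≤ 1) (hφ : Continuous φ) :
    (fun z => ∫ z', empRisk z' φ (F z) ∂(sampleLaw D m)) =ᵐ[sampleLaw D m]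
      fun z => risk D φ (F z) := by
  filter_upwards [hF.dualBound] with z hd
  exact integral_empRisk hm (integrable_loss hY hφ
    (hF.measurable.comp measurable_prodMk_left) (hd.abs_apply_le hS_bdd))

theorem integrable_risk (hF : IsBoundedEstimator D S b F) (hm : 0 < m)
    (hY : ∀ᵐ z ∂D, z.2 = 1 ∨ z.2 = -1) (hS_bdd : ∀ g ∈ S, ∀ x, |g x| ≤ 1) (hφ : Continuous φ) :
    Integrable (fun z => risk D φ (F z)) (sampleLaw D m) :=
  (hF.integrable_empRisk_prod hm hY hS_bdd hφ).integral_prod_left.congr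
    (hF.ae_integral_empRisk_eq hm hY hS_bdd hφ)

end IsBoundedEstimator

/-- Exchange the two entries of the `i`-th pair whenever `σ i = -1`. -/
def signSwap {α : Type*} {m : ℕ} (σ : Fin m → ℤˣ) (w : Fin m → α × α) : Fin m → α × α :=
  fun i => if σ i = 1 then w i else (w i).swap

theorem measurePreserving_signSwap {α : Type*} [MeasurableSpace α] (μ : Measure α)
    [SigmaFinite μ] {m : ℕ} (σ : Fin m → ℤˣ) :
    MeasurePreserving (signSwap (α := α) σ) (Measure.pi fun _ => μ.prod μ)
      (Measure.pi fun _ => μ.prod μ) := by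
  refine measurePreserving_pi (fun _ : Fin m => μ.prod μ) (fun _ => μ.prod μ)
    (f := fun i p => if σ i = 1 then p else p.swap) fun i => ?_
  by_cases h : σ i = 1
  · simp only [h, if_true]
    exact MeasurePreserving.id _
  · simpa [h] using Measure.measurePreserving_swap (μ := μ) (ν := μ)

/-- The expected gap between risk and empirical risk of an estimator is at most twice the Lipschitz
constant of the loss times the Rademacher complexity of its range.  Symmetrization is applied to the
estimator itself and not to a supremum over its range, which need not be measurable. -/
theorem IsBoundedEstimator.integral_risk_le {S : Set (X → ℝ)} {b γ : ℝ} {m : ℕ}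
    {F : (Fin m → X × ℝ) → X → ℝ} {φ : ℝ → ℝ} (hF : IsBoundedEstimator D S b F) (hm : 0 < m)
    (hY : ∀ᵐ z ∂D, z.2 = 1 ∨ z.2 = -1) (hS : S.Nonempty) (hS_bdd : ∀ g ∈ S, ∀ x, |g x| ≤ 1)
    (hS_neg : ∀ g ∈ S, -g ∈ S)
    (hS_rad : AEStronglyMeasurable (fun z : Fin m → X × ℝ => empRademacher S (fun i => (z i).1))
      (sampleLaw D m)) (hφ : Continuous φ)
    (hγ : ∀ u v : ℝ, |u| ≤ b → |v| ≤ b → |φ u - φ v| ≤ γ * |u - v|) :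
    ∫ z, risk D φ (F z) ∂(sampleLaw D m) ≤
      ∫ z, empRisk z φ (F z) ∂(sampleLaw D m) + 2 * (|γ| * b * rademacher D S m) := by
  set P := sampleLaw D m with hP
  set PP : Measure (Fin m → (X × ℝ) × (X × ℝ)) := Measure.pi fun _ => D.prod D with hPP
  let E : (Fin m → X × ℝ) → ℝ := fun z => empRademacher S fun i => (z i).1
  let Ψ : (Fin m → X × ℝ) × (Fin m → X × ℝ) → ℝ := fun q =>
    empRisk q.2 φ (F q.1) - empRisk q.1 φ (F q.1)
  let pair : (Fin m → (X × ℝ) × (X × ℝ)) → (Fin m → X × ℝ) × (Fin m → X × ℝ) :=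
    fun w => (fun i => (w i).1, fun i => (w i).2)
  have hpair : MeasurePreserving pair PP (P.prod P) :=
    measurePreserving_arrowProdEquivProdArrow (X × ℝ) (X × ℝ) (Fin m) (fun _ => D) (fun _ => D)
  have hfst : MeasurePreserving (fun w : Fin m → (X × ℝ) × (X × ℝ) => fun i => (w i).1) PP P :=
    measurePreserving_pi (fun _ : Fin m => D.prod D) (fun _ => D) fun _ => measurePreserving_fst
  have hsnd : MeasurePreserving (fun w : Fin m → (X × ℝ) × (X × ℝ) => fun i => (w i).2) PP P :=
    measurePreserving_pi (fun _ : Fin m => D.prod D) (fun _ => D) fun _ => measurePreserving_snd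
  have hemp := hF.integrable_empRisk hm hY hS_bdd hφ
  have hdiag : Integrable (fun q : (Fin m → X × ℝ) × (Fin m → X × ℝ) => empRisk q.1 φ (F q.1))
      (P.prod P) := hemp.comp_fst P
  have hprod := hF.integrable_empRisk_prod hm hY hS_bdd hφ
  have hΨ : Integrable Ψ (P.prod P) := hprod.sub hdiag
  have hgap : ∫ q, Ψ q ∂(P.prod P) = ∫ z, risk D φ (F z) ∂P - ∫ z, empRisk z φ (F z) ∂P := by
    rw [integral_sub hprod hdiag, integral_prod _ hprod,
      integral_congr_ae (hF.ae_integral_empRisk_eq hm hY hS_bdd hφ)]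
    congr 1
    exact integral_comp_measurePreserving measurePreserving_fst hemp.aestronglyMeasurable
  have hswap : ∀ σ : Fin m → ℤˣ, MeasurePreserving (fun w => pair (signSwap σ w)) PP (P.prod P) :=
    fun σ => hpair.comp (measurePreserving_signSwap D σ)
  have hΨσ : ∀ σ : Fin m → ℤˣ, Integrable (fun w => Ψ (pair (signSwap σ w))) PP := fun σ =>
    (hswap σ).integrable_comp_of_integrable hΨ
  have hE : Integrable E P := by
    refine Integrable.of_bound (C := 1) hS_rad (Eventually.of_forall fun z => ?_)
    rw [Real.norm_of_nonneg (empRademacher_nonneg hS_bdd hS_neg _)]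
    exact empRademacher_le_one hS_bdd _
  have hE1 := hfst.integrable_comp_of_integrable hE
  have hE2 := hsnd.integrable_comp_of_integrable hE
  have hpoint : ∀ᵐ w ∂PP, ∑ σ : Fin m → ℤˣ, Ψ (pair (signSwap σ w)) ≤
      |γ| * b * 2 ^ m * (E (fun i => (w i).1) + E fun i => (w i).2) := by
    have hd : ∀ᵐ w ∂PP, ∀ σ : Fin m → ℤˣ, DualBound S (F (pair (signSwap σ w)).1) b :=
      ae_all_iff.2 fun σ => (hswap σ).quasiMeasurePreserving.ae
        (Measure.quasiMeasurePreserving_fst.ae hF.dualBound)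
    filter_upwards [hd, hfst.quasiMeasurePreserving.ae (ae_sample_label hY m),
      hsnd.quasiMeasurePreserving.ae (ae_sample_label hY m)] with w hd h1 h2
    -- Averaging over `σ` is what lets the contraction principle act on the two halves
    -- separately, although the estimator changes with `σ`.
    have e : ∀ σ : Fin m → ℤˣ, Ψ (pair (signSwap σ w)) =
        ∑ i, ((σ i : ℤ) : ℝ) *
          (1 / (m : ℝ) * φ (F (pair (signSwap σ w)).1 (w i).2.1 * (w i).2.2)) +
        ∑ i, ((σ i : ℤ) : ℝ) *
          (1 / (m : ℝ) * -φ (F (pair (signSwap σ w)).1 (w i).1.1 * (w i).1.2)) := fun σ => by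
      simp only [Ψ, empRisk]
      rw [← mul_sub, ← Finset.sum_sub_distrib, ← Finset.sum_add_distrib, Finset.mul_sum]
      refine Finset.sum_congr rfl fun i _ => ?_
      generalize F (pair (signSwap σ w)).1 = f
      rcases Int.units_eq_one_or (σ i) with h | h
      · simp only [pair, signSwap, h, if_true]
        push_cast
        ring
      · simp only [pair, signSwap, h, if_neg (show ¬(-1 : ℤˣ) = 1 by decide), Prod.fst_swap,
          Prod.snd_swap]
        push_cast
        ring
    have hc2 := sum_sign_sum_le_empRademacher hS hS_bdd hS_neg (fun i => (w i).2) h2 hγ hd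
    have hc1 := sum_sign_sum_le_empRademacher hS hS_bdd hS_neg (fun i => (w i).1) h1
      (φ := fun a => -φ a) (γ := γ)
      (fun u v hu hv => by rw [neg_sub_neg, abs_sub_comm]; exact hγ u v hu hv) hd
    simp only [e, Finset.sum_add_distrib]
    simp only [E]
    linarith
  have hint := integral_mono_ae (integrable_finsetSum _ fun σ _ => hΨσ σ)
    ((hE1.add hE2).const_mul (|γ| * b * 2 ^ m)) hpoint
  rw [integral_finsetSum _ fun σ _ => hΨσ σ, integral_const_mul] at hint
  have hsum : ∑ σ : Fin m → ℤˣ, ∫ w, Ψ (pair (signSwap σ w)) ∂PP =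
      2 ^ m * ∫ q, Ψ q ∂(P.prod P) := by
    simp only [fun σ => integral_comp_measurePreserving (hswap σ) hΨ.aestronglyMeasurable]
    simp
  have hrad : ∫ w, (((E ∘ fun w i => (w i).1) + E ∘ fun w i => (w i).2) :
      (Fin m → (X × ℝ) × (X × ℝ)) → ℝ) w ∂PP = 2 * rademacher D S m := by
    rw [integral_add' hE1 hE2]
    simp only [Function.comp_apply]
    rw [integral_comp_measurePreserving hfst hE.aestronglyMeasurable,
      integral_comp_measurePreserving hsnd hE.aestronglyMeasurable, two_mul]
    rfl
  rw [hsum, hrad, hgap] at hint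
  have h2 : (0 : ℝ) < 2 ^ m := by positivity
  have hfin := le_of_mul_le_mul_left (hint.trans_eq
    (by ring : _ = 2 ^ m * (2 * (|γ| * b * rademacher D S m)))) h2
  linarith

/-! ### Consistency -/

theorem measurable_of_mem_span {X : Type*} [MeasurableSpace X] {S : Set (X → ℝ)}
    (hS : ∀ g ∈ S, Measurable g) {f : X → ℝ} (hf : f ∈ Submodule.span ℝ S) : Measurable f := by
  obtain ⟨n, w, g, hg, rfl⟩ := exists_eq_sum_of_mem_span hf
  rw [Finset.sum_fn]
  exact Finset.measurable_sum _ fun j _ => (hS _ (hg j)).const_smul (w j)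

/-- A Lipschitz constant on `[-b, b]` is nonnegative unless the interval is a single point, where
the factor `b` vanishes. -/
theorem abs_mul_eq_of_lipschitz {φ : ℝ → ℝ} {b γ : ℝ} (hb : 0 ≤ b)
    (hγ : ∀ u v : ℝ, |u| ≤ b → |v| ≤ b → |φ u - φ v| ≤ γ * |u - v|) : |γ| * b = γ * b := by
  rcases hb.eq_or_lt with rfl | hb
  · simp
  have h := (abs_nonneg _).trans (hγ b 0 (abs_of_pos hb).le (by simpa using hb.le))
  rw [sub_zero, abs_of_pos hb] at h
  rw [abs_of_nonneg (nonneg_of_mul_nonneg_left h hb)]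

end Boosting

end

theorem theorem3p1 {X : Type*} [MeasurableSpace X]
    -- the distribution of (X, Y), with Y = ±1
    (D : Measure (X × ℝ)) [IsProbabilityMeasure D]
    (hY : ∀ᵐ z ∂D, z.2 = 1 ∨ z.2 = -1)
    -- the basis functions
    (S : Set (X → ℝ)) (hS_meas : ∀ g ∈ S, Measurable g)
    (hS_bdd : ∀ g ∈ S, ∀ x, |g x| ≤ 1) (hS_neg : ∀ g ∈ S, -g ∈ S)
    (hS_rad : ∀ m : ℕ, 0 < m → AEStronglyMeasurable
      (fun z : Fin m → X × ℝ => Boosting.empRademacher S (fun i => (z i).1))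
      (Boosting.sampleLaw D m))
    -- the loss function, and Lipschitz constants of it on the intervals [-b, b]
    (L : Boosting.Loss) (γ : ℝ → ℝ)
    (hγ : ∀ b u v : ℝ, |u| ≤ b → |v| ≤ b → |L.phi u - L.phi v| ≤ γ b * |u - v|)
    -- sample-independent starting point, tolerances and step sets
    (f₀ : X → ℝ) (hf₀ : f₀ ∈ Submodule.span ℝ S)
    (ε : ℕ → ℝ) (hε_nonneg : ∀ k, 0 ≤ ε k) (hε_sum : Summable ε)
    (Λ : ℕ → Set ℝ) (hΛ_closed : ∀ k, IsClosed (Λ k)) (hΛ_zero : ∀ k, (0 : ℝ) ∈ Λ k)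
    (hΛ_neg : ∀ k, ∀ a ∈ Λ k, -a ∈ Λ k)
    (h : ℕ → ℝ) (hh_sup : ∀ k, IsLUB (Λ k) (h k))
    (hh_sum : Tendsto (fun n => ∑ k ∈ Finset.range n, h k) atTop atTop)
    (hh_sq : Summable fun k => h k ^ 2)
    -- sample-independent sequences controlling the stopping rule
    (kmin : ℕ → ℕ) (hkmin : Tendsto kmin atTop atTop)
    (β : ℕ → ℝ)
    (hβ : Tendsto (fun m => γ (β m) * β m * Boosting.rademacher D S m) atTop (𝓝 0))
    -- boosting iterates and stopping step as functions of the sample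
    (fhat : (m : ℕ) → (Fin m → X × ℝ) → ℕ → X → ℝ)
    (khat : (m : ℕ) → (Fin m → X × ℝ) → ℕ)
    (hrun : ∀ m : ℕ, 0 < m → ∀ᵐ z ∂(Boosting.sampleLaw D m),
      Boosting.IsGreedyBoosting S (Boosting.empObjective L z) f₀ ε Λ (khat m z) (fhat m z) ∧
      kmin m ≤ khat m z ∧
      Boosting.oneNorm S (fhat m z (khat m z)) ≤ β m)
    -- the boosting estimator is a measurable function of the sample and the point
    (hmeas : ∀ m : ℕ, 0 < m → Measurable
      fun q : (Fin m → X × ℝ) × X => fhat m q.1 (khat m q.1) q.2) :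
    (∀ f ∈ Submodule.span ℝ S, Integrable (fun z : X × ℝ => L.phi (f z.1 * z.2)) D) ∧
    (∀ m : ℕ, 0 < m → Integrable
      (fun z => Boosting.risk D L.phi (fhat m z (khat m z))) (Boosting.sampleLaw D m)) ∧
    Tendsto
      (fun m => ∫ z, Boosting.risk D L.phi (fhat m z (khat m z)) ∂(Boosting.sampleLaw D m))
      atTop
      (𝓝 (⨅ f : Submodule.span ℝ S, Boosting.risk D L.phi (f : X → ℝ))) := by
  have hφ := L.phi_continuous
  have hint : ∀ f ∈ Submodule.span ℝ S, Integrable (fun z : X × ℝ => L.phi (f z.1 * z.2)) D := by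
    intro f hf
    obtain ⟨r, -, hr⟩ := Boosting.exists_dualBound_of_mem_span hf
    exact Boosting.integrable_loss hY hφ (Boosting.measurable_of_mem_span hS_meas hf)
      (hr.abs_apply_le hS_bdd)
  have hspan : ∀ m, 0 < m → ∀ᵐ z ∂(Boosting.sampleLaw D m),
      fhat m z (khat m z) ∈ Submodule.span ℝ S := fun m hm => by
    filter_upwards [hrun m hm] with z hz
    exact hz.1.mem_span hf₀ le_rfl
  have hF : ∀ m, 0 < m →
      Boosting.IsBoundedEstimator D S (β m) fun z => fhat m z (khat m z) := fun m hm => by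
    refine ⟨hmeas m hm, ?_⟩
    filter_upwards [hrun m hm, hspan m hm] with z hz hs
    exact (Boosting.dualBound_oneNorm hs).mono hz.2.2
  have hrisk : ∀ m, 0 < m → Integrable
      (fun z => Boosting.risk D L.phi (fhat m z (khat m z))) (Boosting.sampleLaw D m) :=
    fun m hm => (hF m hm).integrable_risk hm hY hS_bdd hφ
  refine ⟨hint, hrisk, ?_⟩
  -- A run with at least one step picks an element of `S`.
  have hS : S.Nonempty := by
    obtain ⟨m, hk, hm⟩ :=
      ((hkmin.eventually_ge_atTop 1).and (eventually_gt_atTop (0 : ℕ))).exists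
    obtain ⟨z, hz⟩ := (hrun m hm).exists
    obtain ⟨α, -, g, hg, -⟩ := hz.1.2 0 (by omega)
    exact ⟨g, hg⟩
  have hgap : ∀ m, 0 < m → |γ (β m)| * β m = γ (β m) * β m := fun m hm => by
    obtain ⟨z, hz⟩ := (hrun m hm).exists
    exact Boosting.abs_mul_eq_of_lipschitz ((Boosting.oneNorm_nonneg _ _).trans hz.2.2)
      (hγ (β m))
  have hbdd : BddBelow (Set.range fun f : Submodule.span ℝ S =>
      Boosting.risk D L.phi (f : X → ℝ)) :=
    ⟨0, by rintro _ ⟨f, rfl⟩; exact integral_nonneg fun z => L.phi_nonneg _⟩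
  rw [tendsto_order]
  constructor
  · intro a ha
    filter_upwards [eventually_gt_atTop 0] with m hm
    refine ha.trans_le ?_
    have h1 : ∫ _z, (⨅ f : Submodule.span ℝ S, Boosting.risk D L.phi (f : X → ℝ))
        ∂(Boosting.sampleLaw D m) ≤
        ∫ z, Boosting.risk D L.phi (fhat m z (khat m z)) ∂(Boosting.sampleLaw D m) := by
      refine integral_mono_ae (integrable_const _) (hrisk m hm) ?_
      filter_upwards [hspan m hm] with z hz
      exact ciInf_le hbdd ⟨_, hz⟩
    simpa using h1
  · intro a ha
    obtain ⟨⟨f', hf'⟩, hlt⟩ := exists_lt_of_ciInf_lt ha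
    obtain ⟨bnd, hbnd, hgreedy⟩ := Boosting.exists_empRisk_greedy_le hS_bdd hS_neg L hf₀ hf'
      hε_nonneg hε_sum hΛ_closed hΛ_zero hΛ_neg hh_sup hh_sum hh_sq
    set δ := (a - Boosting.risk D L.phi f') / 4 with hδ
    have hδ0 : 0 < δ := div_pos (sub_pos.2 hlt) (by norm_num)
    obtain ⟨N, hN⟩ := eventually_atTop.1 (hbnd.eventually_lt_const hδ0)
    filter_upwards [eventually_gt_atTop 0, hkmin.eventually_ge_atTop N,
      hβ.eventually_lt_const hδ0] with m hm hk hR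
    have h1 := (hF m hm).integral_risk_le hm hY hS hS_bdd hS_neg (hS_rad m hm) hφ (hγ (β m))
    rw [hgap m hm] at h1
    have hemp : Integrable (fun z => Boosting.empRisk z L.phi f') (Boosting.sampleLaw D m) := by
      refine Integrable.const_mul (integrable_finsetSum _ fun i _ => ?_) _
      exact (Boosting.measurePreserving_sample_eval m i).integrable_comp_of_integrable
        (hint f' hf')
    have h2 : ∫ z, Boosting.empRisk z L.phi (fhat m z (khat m z)) ∂(Boosting.sampleLaw D m) ≤
        ∫ z, (Boosting.empRisk z L.phi f' + δ) ∂(Boosting.sampleLaw D m) := by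
      refine integral_mono_ae ((hF m hm).integrable_empRisk hm hY hS_bdd hφ)
        (hemp.add (integrable_const δ)) ?_
      filter_upwards [hrun m hm, Boosting.ae_sample_label hY m] with z hz hl
      exact (hgreedy m hm z hl _ _ hz.1).trans
        (add_le_add_right (hN _ (hk.trans hz.2.1)).le _)
    rw [integral_add hemp (integrable_const δ), Boosting.integral_empRisk hm (hint f' hf')] at h2
    simp only [integral_const, probReal_univ, one_smul] at h2
    linarith
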